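/- **Setting.** Let $p\ge 1$, $n\ge 1$, $0=u_0<u_1<\dots<u_n=1$, and let $N_{i,p}$ ($0\le i\le n+p-1$) be the B-spline basis functions of degree $p$ on the knot vector $\{\underbrace{0,\dots,0}_{p+1},u_1,\dots,u_{n-1},\underbrace{1,\dots,1}_{p+1}\}$ (all interior knots simple; the last knot interval is closed at $1$). Let $\mathbf P_0,\dots,\mathbf P_{n+p-1}\in\mathbb R^d$ be control points, $\omega_0,\dots,\omega_{n+p-1}>0$ weights and $\lambda:\{0,\dots,n+p-1\}\to\mathbb R$ a lifting function. For $t>0$ let $$\mathbf R_t=\left\{\frac{\sum_{i=0}^{n+p-1}t^{\lambda(i)}\omega_i\mathbf P_iN_{i,p}(x)}{\sum_{i=0}^{n+p-1}t^{\lambda(i)}\omega_iN_{i,p}(x)}\;:\;x\in[0,1]\right\}$$ be the NURBS curve with weights $t^{\lambda(i)}\omega_i$. **Knot insertion.** Insert each interior knot $u_1,\dots,u_{n-1}$ further $p-1$ times by Boehm's algorithm, and let $f_{k,i}$ ($0\le k\le np$, $0\le i\le n+p-1$) be the resulting coefficients: a NURBS curve with weights $w_i$ and control points $\mathbf P_i$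 acquires the weights $\sum_i f_{k,i}w_i$ and control points $\sum_i f_{k,i}w_i\mathbf P_i/\sum_i f_{k,i}w_i$. For $m=1,\dots,n$ the $m$-th piece (on $[u_{m-1},u_m]$) is the rational Bézier curve of degree $p$ whose weights and control points are those with index $k\in\mathcal A^m=\{(m-1)p,\dots,mp\}$. **Induced lifting.** For $k=(m-1)p+j\in\mathcal A^m$ let $W^m_k\subset\{0,\dots,n+p-1\}$ be the following set of consecutive integers: for $j=0$, $W^m_k=\{0\}$ if $m=1$ and $\{m-1,\dots,m+p-2\}$ if $m>1$; for $j=p$, $W^m_k=\{n+p-1\}$ if $m=n$ and $\{m,\dots,m+p-1\}$ if $m<n$; for $0<j<p$, $W^m_k=\{a,\dots,b\}$ with $a=m$ if $m<n$, $a=n+j-1$ if $m=n$, and $b=j$ if $m=1$, $b=m+p-2$ if $m>1$. Put $$\lambda^m(k)=\max_{i\in W^m_k}\lambda(i),\quad \psi^m_k=\{i\in W^m_k:\lambda(i)=\lambda^m(k)\},\quad \bar\omega^m_k=\sum_{i\in\psi^m_k}f_{k,i}\,\omega_i,\quad \bar{\mathbf P}^m_k=\frac1{\bar\omega^m_k}\sum_{i\in\psi^m_k}f_{k,i}\,\omega_i\mathbf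 P_i .$$ **Regular decomposition.** Let $S^m_\lambda$ be the collection of all sets $s=\{k\in\mathcal A^m:(k,\lambda^m(k))\in e\}$, where $e$ runs over the upper edges of $\mathrm{conv}\{(k,\lambda^m(k)):k\in\mathcal A^m\}\subset\mathbb R^2$, i.e. the edges that have an outward normal vector with positive last coordinate. **Regular control curve.** For $s\in S^m_\lambda$ with $a_0=\min s$ and $a_1=\max s$ let $$\mathbf F^m_s=\left\{\frac{\sum_{k\in s}\bar\omega^m_k\beta_k(x)\,\bar{\mathbf P}^m_k}{\sum_{k\in s}\bar\omega^m_k\beta_k(x)}:x\in[a_0,a_1]\right\},\qquad \beta_k(x)=\binom{p}{k-(m-1)p}p^{-p}\,(x-a_0)^{k-a_0}(a_1-x)^{a_1-k},$$ and define the regular control curve of the NURBS curve induced by $\lambda$ as $\mathbf R(\bar S_\lambda)=\bigcup_{m=1}^n\bigcup_{s\in S^m_\lambda}\mathbf F^m_s$. **Theorem.** As $t\to\infty$, $\mathbf R_t$ converges to $\mathbf R(\bar S_\lambda)$ in the Hausdorff distance. -/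

import Mathlib

noncomputable section

namespace NURBS

/-! ### NURBS curves

Finite sequences `x₀, …, x_N` are stored as functions on `ℕ`; only the entries that occur in the
respective sums matter. `u 0 = 0 < u 1 < ⋯ < u n = 1` are the breakpoints, `p` is the degree, and
the control points are `P 0, …, P (n + p - 1)`. -/

/-- The knot vector `{0, …, 0, u₁, …, u_{n-1}, 1, …, 1}` with `p + 1` zeros and `p + 1` ones
(the value `1` is repeated after the last knot, which has index `n + 2 p`). -/
def knotVector (p n : ℕ) (u : ℕ → ℝ) (i : ℕ) : ℝ := u (min (i - p) n)

/-- The B-spline basis function `N_{i,q}` on the knots `U` with last knot `1`, by the Cox–de Boor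
recursion with `0 / 0 = 0`. As usual the last nonempty knot interval is closed on the right, so
that the functions are defined on all of `[0, 1]`. -/
def bsplineBasis (U : ℕ → ℝ) : ℕ → ℕ → ℝ → ℝ
  | 0, i, x =>
      if (U i ≤ x ∧ x < U (i + 1)) ∨ (x = 1 ∧ U i < 1 ∧ U (i + 1) = 1) then 1 else 0
  | q + 1, i, x =>
      (x - U i) / (U (i + q + 1) - U i) * bsplineBasis U q i x +
        (U (i + q + 2) - x) / (U (i + q + 2) - U (i + 1)) * bsplineBasis U q (i + 1) x

/-- The parametrization `R(x) = ∑ ωᵢ Pᵢ N_{i,p}(x) / ∑ ωᵢ N_{i,p}(x)`. -/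
def nurbsPoint {E : Type*} [AddCommGroup E] [Module ℝ E] (p n : ℕ) (u : ℕ → ℝ) (w : ℕ → ℝ)
    (P : ℕ → E) (x : ℝ) : E :=
  (∑ i ∈ Finset.range (n + p), w i * bsplineBasis (knotVector p n u) p i x)⁻¹ •
    ∑ i ∈ Finset.range (n + p), (w i * bsplineBasis (knotVector p n u) p i x) • P i

/-- The NURBS curve as a set: the image of `[0, 1]`. -/
def nurbsCurve {E : Type*} [AddCommGroup E] [Module ℝ E] (p n : ℕ) (u : ℕ → ℝ) (w : ℕ → ℝ)
    (P : ℕ → E) : Set E :=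
  nurbsPoint p n u w P '' Set.Icc 0 1

/-- The weights `t ^ λ(i) * ωᵢ`. -/
def liftedWeights (lam w : ℕ → ℝ) (t : ℝ) (i : ℕ) : ℝ := t ^ lam i * w i

/-! ### Knot insertion -/

/-- The knot vector obtained from the nondecreasing `U` by inserting the knot `x`. -/
def insertKnot (U : ℕ → ℝ) (x : ℝ) (i : ℕ) : ℝ :=
  if U i ≤ x then U i else if U (i - 1) ≤ x then x else U (i - 1)

/-- The ratio `αᵢ` of Boehm's algorithm for inserting `x`: with `U s ≤ x < U (s + 1)` it is `1` for
`i ≤ s - p`, `(x - Uᵢ) / (U_{i+p} - Uᵢ)` for `s - p < i ≤ s`, and `0` for `i > s`. -/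
def boehmRatio (p : ℕ) (U : ℕ → ℝ) (x : ℝ) (i : ℕ) : ℝ :=
  if U (i + p) ≤ x then 1 else if x ≤ U i then 0 else (x - U i) / (U (i + p) - U i)

/-- One step of Boehm's algorithm, `Qᵢ = αᵢ Pᵢ + (1 - αᵢ) P_{i-1}`, on (homogeneous) control
coefficients. -/
def insertCoeff (p : ℕ) (U : ℕ → ℝ) (x : ℝ) (c : ℕ → ℝ) (i : ℕ) : ℝ :=
  boehmRatio p U x i * c i + (1 - boehmRatio p U x i) * c (i - 1)

/-- The control coefficients after the successive insertion of a list of knots. -/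
def insertCoeffs (p : ℕ) : (ℕ → ℝ) → List ℝ → (ℕ → ℝ) → ℕ → ℝ
  | _, [], c => c
  | U, x :: L, c => insertCoeffs p (insertKnot U x) L (insertCoeff p U x c)

/-- Each interior knot `u₁, …, u_{n-1}`, `p - 1` times. -/
def insertedKnots (p n : ℕ) (u : ℕ → ℝ) : List ℝ :=
  (List.range (n - 1)).flatMap fun r => List.replicate (p - 1) (u (r + 1))

/-- The coefficient of the `i`-th original (homogeneous) control point in the `k`-th one
(`k = 0, …, n p`) after all interior knots have been raised to multiplicity `p`: the weights of the
resulting Bézier pieces are `∑ᵢ f k i * ωᵢ` and the control points are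
`∑ᵢ f k i * ωᵢ • Pᵢ / ∑ᵢ f k i * ωᵢ`. -/
def insertionCoeff (p n : ℕ) (u : ℕ → ℝ) (k i : ℕ) : ℝ :=
  insertCoeffs p (knotVector p n u) (insertedKnots p n u) (Pi.single i 1) k

/-! ### Rational Bézier curves indexed by lattice points and regular decompositions -/

/-- The toric Bézier basis function `c_a (x - a₀) ^ (a - a₀) * (a₁ - x) ^ (a₁ - a)` of the finite
set `s` of lattice points, where `a₀ = min s` and `a₁ = max s`. -/
def toricBasis (s : Finset ℕ) (c : ℕ → ℝ) (a : ℕ) (x : ℝ) : ℝ :=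
  c a * (x - (sInf (s : Set ℕ) : ℕ)) ^ (a - sInf (s : Set ℕ)) *
    ((sSup (s : Set ℕ) : ℕ) - x) ^ (sSup (s : Set ℕ) - a)

/-- The image of `[min s, max s]` under the rational Bézier curve with lattice points `s`, basis
coefficients `c`, weights `w` and control points `b`. -/
def toricCurve {E : Type*} [AddCommGroup E] [Module ℝ E] (s : Finset ℕ) (c w : ℕ → ℝ)
    (b : ℕ → E) : Set E :=
  (fun x : ℝ => (∑ a ∈ s, w a * toricBasis s c a x)⁻¹ • ∑ a ∈ s, (w a * toricBasis s c a x) • b a) ''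
    Set.Icc ((sInf (s : Set ℕ) : ℕ) : ℝ) ((sSup (s : Set ℕ) : ℕ) : ℝ)

/-- The convex hull of the lifted points `(a, λ(a))`, `a ∈ A`. -/
def liftedPolygon (A : Finset ℕ) (lam : ℕ → ℝ) : Set (ℝ × ℝ) :=
  convexHull ℝ ((fun a : ℕ => ((a : ℝ), lam a)) '' (A : Set ℕ))

/-- `e` is an upper edge of `Q`: a face with more than one point that has an outward normal vector
`(v₁, v₂)` with `v₂ > 0`. -/
def IsUpperEdge (Q e : Set (ℝ × ℝ)) : Prop :=
  e.Nontrivial ∧ ∃ v : ℝ × ℝ, 0 < v.2 ∧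
    e = {x ∈ Q | ∀ y ∈ Q, v.1 * y.1 + v.2 * y.2 ≤ v.1 * x.1 + v.2 * x.2}

open scoped Classical in
/-- The regular decomposition of `A` induced by `λ`: for each upper edge, the set of the `a ∈ A`
whose lifted points lie on it. -/
def regularDecomposition (A : Finset ℕ) (lam : ℕ → ℝ) : Set (Finset ℕ) :=
  {s | ∃ e, IsUpperEdge (liftedPolygon A lam) e ∧ s = A.filter fun a : ℕ => ((a : ℝ), lam a) ∈ e}

/-! ### The regular control curve of a NURBS curve

The Bézier pieces are numbered `m = 0, …, n - 1`; piece `m` lives on `[u m, u (m + 1)]` and its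
lattice points are `m p, m p + 1, …, (m + 1) p`. -/

/-- The lattice points of piece `m`. -/
def pieceLattice (p m : ℕ) : Finset ℕ := Finset.Icc (m * p) ((m + 1) * p)

/-- The basis coefficients `binom(p, j) p^{-p}` at the lattice point `m p + j` of piece `m`, for
which the toric basis functions are the Bernstein polynomials. -/
def pieceBasisCoeff (p m k : ℕ) : ℝ := (p.choose (k - m * p) : ℝ) / (p : ℝ) ^ p

/-- The range `{a, …, b}` of the original control points of which the control point with index
`m p + j` (`0 ≤ j ≤ p`) is a convex combination. -/
def window (p n m j : ℕ) : Finset ℕ :=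
  if j = 0 then
    if m = 0 then {0} else Finset.Icc m (m + p - 1)
  else if j = p then
    if m + 1 = n then {n + p - 1} else Finset.Icc (m + 1) (m + p)
  else
    Finset.Icc (if m + 1 = n then m + j else m + 1) (if m = 0 then j else m + p - 1)

/-- The lifting function of piece `m`: the maximum of `λ` over the window. -/
def pieceLift (p n : ℕ) (lam : ℕ → ℝ) (m k : ℕ) : ℝ :=
  sSup (lam '' (window p n m (k - m * p) : Set ℕ))

/-- The points of the window at which `λ` is largest. -/
def dominant (p n : ℕ) (lam : ℕ → ℝ) (m k : ℕ) : Finset ℕ :=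
  (window p n m (k - m * p)).filter fun i => ∀ i' ∈ window p n m (k - m * p), lam i' ≤ lam i

/-- The limit weight at the lattice point `k` of piece `m`. -/
def limitWeight (p n : ℕ) (u lam w : ℕ → ℝ) (m k : ℕ) : ℝ :=
  ∑ i ∈ dominant p n lam m k, insertionCoeff p n u k i * w i

/-- The limit control point at the lattice point `k` of piece `m`. -/
def limitPoint {E : Type*} [AddCommGroup E] [Module ℝ E] (p n : ℕ) (u lam w : ℕ → ℝ)
    (P : ℕ → E) (m k : ℕ) : E :=
  (limitWeight p n u lam w m k)⁻¹ •
    ∑ i ∈ dominant p n lam m k, (insertionCoeff p n u k i * w i) • P i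

/-- The regular control curve of the NURBS curve induced by the lifting function `λ`: the union,
over the Bézier pieces `m` and the members `s` of the regular decomposition of piece `m`, of the
rational Bézier curves with the limit weights and limit control points indexed by `s`. -/
def regularControlCurve {E : Type*} [AddCommGroup E] [Module ℝ E] (p n : ℕ) (u lam w : ℕ → ℝ)
    (P : ℕ → E) : Set E :=
  ⋃ m ∈ Finset.range n,
    ⋃ s ∈ regularDecomposition (pieceLattice p m) (pieceLift p n lam m),
      toricCurve s (pieceBasisCoeff p m) (limitWeight p n u lam w m) (limitPoint p n u lam w P m)

end NURBS

end

noncomputable section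

namespace NURBS

open Filter Topology

/-! ### Upper faces and regular decompositions -/

/-! Knot insertion does not change the curve, and once every interior knot has multiplicity `p` the
B-splines on each knot interval are Bernstein polynomials. So the NURBS curve is a union of `n`
rational Bézier pieces with weights `∑ i, f k i * t ^ λ i * ω i`
(`nurbsCurve_eq_biUnion_toricCurve`). The coefficient `f k i` is positive exactly when `i` lies in
the window of `k` (`insertionCoeff_support`, `mem_window_iff`). Hence the largest `λ` in the window
governs the weight: divided by `t ^ λ^m(k)` it tends to the positive limit weight, and the control
points converge to the limit points (`tendsto_insertedWeight`, `tendsto_insertedPoint`).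

What remains is the degeneration of one piece (`tendsto_hausdorffEDist_toricCurve`). Up to a common
factor its basis functions are monomials `c k * σ ^ k` with `σ > 0`, so its terms have size `t ^
λ(k) * σ ^ k`. Replacing `σ` by `σ * t ^ θ` and dividing by the largest power of `t` leaves only the
lattice points that maximize `λ(k) + θ k`, an upper face; so every point of the claimed limit is
approached.

Conversely, let `τ(t) > 0` be arbitrary and pass to an ultrafilter along which one term is largest
and all ratios to it converge. If a second ratio has a nonzero limit, the tie determines `θ`, `τ(t)
/ t ^ θ` has a positive limit, and the limit point lies on the curve of an upper edge. Otherwise the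
limit is a single control point, whose lattice point is a vertex of the upper hull and hence an end
point of an edge (`exists_mem_regularDecomposition_of_strict_max`). Compactness makes both
directions uniform, and there are only finitely many pieces. -/

open scoped Classical in
/-- The lattice points of `A` at which `λ(k) + θ k` is largest. -/
def upperFace (A : Finset ℕ) (lam : ℕ → ℝ) (θ : ℝ) : Finset ℕ :=
  A.filter fun k => ∀ l ∈ A, lam l + θ * l ≤ lam k + θ * k

theorem mem_upperFace {A : Finset ℕ} {lam : ℕ → ℝ} {θ : ℝ} {k : ℕ} :
    k ∈ upperFace A lam θ ↔ k ∈ A ∧ ∀ l ∈ A, lam l + θ * l ≤ lam k + θ * k := by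
  classical
  simp [upperFace]

theorem forall_liftedPolygon_le_iff {A : Finset ℕ} {lam : ℕ → ℝ} (v : ℝ × ℝ) (r : ℝ) :
    (∀ y ∈ liftedPolygon A lam, v.1 * y.1 + v.2 * y.2 ≤ r) ↔
      ∀ l ∈ A, v.1 * l + v.2 * lam l ≤ r := by
  constructor
  · intro h l hl
    exact h _ (subset_convexHull ℝ _ ⟨l, hl, rfl⟩)
  · intro h y hy
    have hconv : Convex ℝ {y : ℝ × ℝ | v.1 * y.1 + v.2 * y.2 ≤ r} := by
      intro x hx y hy a b ha hb hab
      simp only [Set.mem_ofPred_eq, Prod.fst_add, Prod.snd_add, Prod.smul_fst, Prod.smul_snd,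
        smul_eq_mul] at *
      have h1 := mul_le_mul_of_nonneg_left hx ha
      have h2 := mul_le_mul_of_nonneg_left hy hb
      have h3 : r = a * r + b * r := by rw [← add_mul, hab, one_mul]
      linarith
    have := convexHull_min (s := (fun a : ℕ => ((a : ℝ), lam a)) '' (A : Set ℕ)) (by
      rintro _ ⟨l, hl, rfl⟩
      exact h l hl) hconv
    exact this hy

/-- A point together with the open half-plane below its supporting line is convex. This shows that a
face containing only one lifted lattice point is a single point, so a nontrivial face carries at
least two. -/
theorem liftedPolygon_subset_of_strict_max {A : Finset ℕ} {lam : ℕ → ℝ} {k : ℕ} (v : ℝ × ℝ)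
    (h : ∀ l ∈ A, l ≠ k → v.1 * l + v.2 * lam l < v.1 * k + v.2 * lam k) :
    ∀ y ∈ liftedPolygon A lam, y = ((k : ℝ), lam k) ∨
      v.1 * y.1 + v.2 * y.2 < v.1 * k + v.2 * lam k := by
  have hconv : Convex ℝ {y : ℝ × ℝ | y = ((k : ℝ), lam k) ∨
      v.1 * y.1 + v.2 * y.2 < v.1 * k + v.2 * lam k} := by
    rw [convex_iff_forall_pos]
    intro x hx y hy a b ha hb hab
    have h3 : v.1 * k + v.2 * lam k = a * (v.1 * k + v.2 * lam k) + b * (v.1 * k + v.2 * lam k) := by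
      rw [← add_mul, hab, one_mul]
    simp only [Set.mem_ofPred_eq, Prod.fst_add, Prod.snd_add, Prod.smul_fst, Prod.smul_snd,
      smul_eq_mul] at *
    rcases hx with rfl | hx <;> rcases hy with rfl | hy
    · left
      rw [← add_smul, hab, one_smul]
    · right
      have h2 := mul_lt_mul_of_pos_left hy hb
      dsimp only
      linarith
    · right
      have h2 := mul_lt_mul_of_pos_left hx ha
      dsimp only
      linarith
    · right
      have h1 := mul_lt_mul_of_pos_left hx ha
      have h2 := mul_lt_mul_of_pos_left hy hb
      linarith
  refine convexHull_min ?_ hconv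
  rintro _ ⟨l, hl, rfl⟩
  by_cases hlk : l = k
  · left; rw [hlk]
  · right; exact h l hl hlk

/-- The regular decomposition consists of the upper faces with more than one lattice point. -/
theorem mem_regularDecomposition_iff {A s : Finset ℕ} {lam : ℕ → ℝ} :
    s ∈ regularDecomposition A lam ↔ s.Nontrivial ∧ ∃ θ, s = upperFace A lam θ := by
  classical
  constructor
  · rintro ⟨e, ⟨hnt, v, hv, he⟩, hs⟩
    have hmem : ∀ k, k ∈ s ↔ k ∈ A ∧ ∀ l ∈ A, v.1 * l + v.2 * lam l ≤ v.1 * k + v.2 * lam k := by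
      intro k
      rw [hs, Finset.mem_filter, he]
      refine and_congr_right fun hk => ?_
      simp only [Set.mem_ofPred_eq]
      rw [forall_liftedPolygon_le_iff]
      exact and_iff_right (subset_convexHull ℝ _ ⟨k, hk, rfl⟩)
    constructor
    · have hA : A.Nonempty := by
        by_contra hA
        rw [Finset.not_nonempty_iff_eq_empty] at hA
        obtain ⟨x, hx, -⟩ := hnt
        rw [he, hA] at hx
        simp [liftedPolygon] at hx
      obtain ⟨k, hk, hmax⟩ := A.exists_max_image (fun l => v.1 * l + v.2 * lam l) hA
      by_contra hns
      replace hns : (s : Set ℕ).Subsingleton := Set.not_nontrivial_iff.1 hns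
      have hks : k ∈ s := (hmem k).2 ⟨hk, hmax⟩
      have hstrict : ∀ l ∈ A, l ≠ k → v.1 * l + v.2 * lam l < v.1 * k + v.2 * lam k := by
        intro l hl hlk
        refine lt_of_le_of_ne (hmax l hl) fun heq => hlk (hns ((hmem l).2 ⟨hl, ?_⟩) hks)
        rw [heq]
        exact hmax
      have hsub : ∀ x ∈ e, x = ((k : ℝ), lam k) := by
        intro x hx
        rw [he] at hx
        refine (liftedPolygon_subset_of_strict_max v hstrict x hx.1).resolve_right ?_
        exact not_lt.2 (hx.2 _ (subset_convexHull ℝ _ ⟨k, hk, rfl⟩))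
      obtain ⟨x, hx, y, hy, hxy⟩ := hnt
      exact hxy ((hsub x hx).trans (hsub y hy).symm)
    · refine ⟨v.1 / v.2, ?_⟩
      ext k
      rw [hmem, mem_upperFace]
      refine and_congr_right fun _ => forall₂_congr fun l _ => ?_
      rw [← mul_le_mul_iff_right₀ (b := lam l + v.1 / v.2 * l) hv]
      have h : ∀ j : ℕ, v.2 * (lam j + v.1 / v.2 * j) = v.1 * j + v.2 * lam j := by
        intro j
        field_simp
        ring
      rw [h, h]
  · rintro ⟨hnt, θ, hs⟩
    obtain ⟨e, he⟩ : ∃ e : Set (ℝ × ℝ), e = {x ∈ liftedPolygon A lam |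
      ∀ y ∈ liftedPolygon A lam, θ * y.1 + 1 * y.2 ≤ θ * x.1 + 1 * x.2} := ⟨_, rfl⟩
    refine ⟨e, ?_⟩
    have hmem : ∀ k ∈ A, k ∈ s ↔ ∀ y ∈ liftedPolygon A lam,
        θ * y.1 + 1 * y.2 ≤ θ * (k : ℝ) + 1 * lam k := by
      intro k hk
      have := forall_liftedPolygon_le_iff (A := A) (lam := lam) (θ, 1) (θ * (k : ℝ) + 1 * lam k)
      dsimp only at this
      rw [this, hs, mem_upperFace, and_iff_right hk]
      refine forall₂_congr fun l _ => ?_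
      rw [one_mul, one_mul, add_comm, add_comm (lam k)]
    have hsA : ∀ k ∈ s, k ∈ A := fun k hk => by
      rw [hs, mem_upperFace] at hk
      exact hk.1
    refine ⟨⟨?_, (θ, 1), one_pos, he⟩, ?_⟩
    · rw [he]
      obtain ⟨k, hk, l, hl, hkl⟩ := hnt
      refine ⟨((k : ℝ), lam k), ⟨subset_convexHull ℝ _ ⟨k, hsA k hk, rfl⟩,
        (hmem k (hsA k hk)).1 hk⟩, ((l : ℝ), lam l), ⟨subset_convexHull ℝ _ ⟨l, hsA l hl, rfl⟩,
        (hmem l (hsA l hl)).1 hl⟩, ?_⟩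
      intro h
      exact hkl (Nat.cast_injective (R := ℝ) (congrArg Prod.fst h))
    · ext k
      rw [Finset.mem_filter, he]
      constructor
      · intro hk
        exact ⟨hsA k hk, subset_convexHull ℝ _ ⟨k, hsA k hk, rfl⟩, (hmem k (hsA k hk)).1 hk⟩
      · rintro ⟨hk, -, h⟩
        exact (hmem k hk).2 h

theorem regularDecomposition_finite (A : Finset ℕ) (lam : ℕ → ℝ) :
    (regularDecomposition A lam).Finite := by
  classical
  refine (A.powerset.finite_toSet).subset ?_
  rintro s ⟨e, -, rfl⟩
  exact Finset.mem_coe.2 (Finset.mem_powerset.2 (Finset.filter_subset _ _))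

/-- A lattice point which is the only maximum of `λ(k) + y k` for some `y` is an end point of a
member of the regular decomposition. -/
theorem exists_mem_regularDecomposition_of_strict_max {A : Finset ℕ} (hA : A.Nontrivial)
    {lam : ℕ → ℝ} {k : ℕ} (hk : k ∈ A) (y : ℝ)
    (h : ∀ l ∈ A, l ≠ k → lam l + y * l < lam k + y * k) :
    ∃ s ∈ regularDecomposition A lam, k ∈ s ∧ ((∀ l ∈ s, k ≤ l) ∨ ∀ l ∈ s, l ≤ k) := by
  classical
  by_cases hmax : ∃ l ∈ A, k < l
  · have hne : (A.filter fun l => k < l).Nonempty := by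
      obtain ⟨l, hl⟩ := hmax
      exact ⟨l, by simpa using hl⟩
    -- The hull edge leaving `k` to the right ends at a point of smallest descent rate; `-θ` is its
    -- slope. Since `y < θ`, the strict inequality at `y` persists for the points left of `k`.
    obtain ⟨r, hr, hmin⟩ := (A.filter fun l => k < l).exists_min_image
      (fun l : ℕ => (lam k - lam l) / ((l : ℝ) - k)) hne
    rw [Finset.mem_filter] at hr
    have hrk : (0 : ℝ) < (r : ℝ) - k := sub_pos.2 (by exact_mod_cast hr.2)
    set θ := (lam k - lam r) / ((r : ℝ) - k) with hθ
    have hyθ : y < θ := by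
      rw [hθ, lt_div_iff₀ hrk]
      linarith [h r hr.1 hr.2.ne']
    have hlt : ∀ l ∈ A, l < k → lam l + θ * l < lam k + θ * k := by
      intro l hl hlk
      have h1 := h l hl hlk.ne
      have h2 : (0 : ℝ) < (k : ℝ) - l := sub_pos.2 (by exact_mod_cast hlk)
      nlinarith
    have hle : ∀ l ∈ A, lam l + θ * l ≤ lam k + θ * k := by
      intro l hl
      rcases lt_trichotomy l k with hlk | rfl | hlk
      · exact (hlt l hl hlk).le
      · exact le_rfl
      · have h1 := hmin l (by simp [hl, hlk])
        have h2 : (0 : ℝ) < (l : ℝ) - k := sub_pos.2 (by exact_mod_cast hlk)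
        rw [le_div_iff₀ h2] at h1
        linarith
    have hreq : lam r + θ * r = lam k + θ * k := by
      have : θ * ((r : ℝ) - k) = lam k - lam r := by rw [hθ, div_mul_cancel₀ _ hrk.ne']
      linarith
    have hks : k ∈ upperFace A lam θ := mem_upperFace.2 ⟨hk, hle⟩
    have hrs : r ∈ upperFace A lam θ := mem_upperFace.2 ⟨hr.1, by rw [hreq]; exact hle⟩
    refine ⟨upperFace A lam θ, mem_regularDecomposition_iff.2
      ⟨⟨k, hks, r, hrs, hr.2.ne⟩, θ, rfl⟩, hks, Or.inl fun l hl => ?_⟩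
    by_contra hlk
    rw [mem_upperFace] at hl
    exact absurd (hl.2 k hk) (not_le.2 (hlt l hl.1 (not_le.1 hlk)))
  · push Not at hmax
    have hne : (A.erase k).Nonempty := by
      obtain ⟨l, hl, hlk⟩ := hA.exists_ne k
      exact ⟨l, by simp [hl, hlk]⟩
    -- Here `k` is the last lattice point, so the edge arriving from the left serves.
    obtain ⟨r, hr, hmaxr⟩ := (A.erase k).exists_max_image
      (fun l : ℕ => (lam l - lam k) / ((k : ℝ) - l)) hne
    rw [Finset.mem_erase] at hr
    have hpos : ∀ l ∈ A, l ≠ k → (0 : ℝ) < (k : ℝ) - l := fun l hl hlk =>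
      sub_pos.2 (by exact_mod_cast lt_of_le_of_ne (hmax l hl) hlk)
    set θ := (lam r - lam k) / ((k : ℝ) - r) with hθ
    have hle : ∀ l ∈ A, lam l + θ * l ≤ lam k + θ * k := by
      intro l hl
      by_cases hlk : l = k
      · rw [hlk]
      · have h1 := hmaxr l (by simp [hl, hlk])
        rw [div_le_iff₀ (hpos l hl hlk)] at h1
        linarith
    have hreq : lam r + θ * r = lam k + θ * k := by
      have : θ * ((k : ℝ) - r) = lam r - lam k := by
        rw [hθ, div_mul_cancel₀ _ (hpos r hr.2 hr.1).ne']
      linarith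
    have hks : k ∈ upperFace A lam θ := mem_upperFace.2 ⟨hk, hle⟩
    have hrs : r ∈ upperFace A lam θ := mem_upperFace.2 ⟨hr.2, by rw [hreq]; exact hle⟩
    exact ⟨upperFace A lam θ, mem_regularDecomposition_iff.2
      ⟨⟨k, hks, r, hrs, hr.1.symm⟩, θ, rfl⟩, hks,
      Or.inr fun l hl => hmax l (mem_upperFace.1 hl).1⟩

/-! ### Toric curves -/

section Toric

variable {E : Type*} [NormedAddCommGroup E] [NormedSpace ℝ E]

theorem tendsto_centerMass {ι α : Type*} {l : Filter α} {s : Finset ι} {f : α → ι → ℝ}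
    {Q : α → ι → E} {f₀ : ι → ℝ} {Q₀ : ι → E} (hf : ∀ i ∈ s, Tendsto (fun t => f t i) l (𝓝 (f₀ i)))
    (hQ : ∀ i ∈ s, Tendsto (fun t => Q t i) l (𝓝 (Q₀ i))) (h₀ : ∑ i ∈ s, f₀ i ≠ 0) :
    Tendsto (fun t => s.centerMass (f t) (Q t)) l (𝓝 (s.centerMass f₀ Q₀)) :=
  ((tendsto_finsetSum s hf).inv₀ h₀).smul
    (tendsto_finsetSum s fun i hi => (hf i hi).smul (hQ i hi))

/-- Weights are homogeneous coordinates. Changes of parameter and rescalings by powers of `t` all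
reduce to this cancellation. -/
theorem centerMass_congr_of_mul {ι : Type*} {s : Finset ι} {f g : ι → ℝ} {b : ι → E} {C : ℝ}
    (hC : C ≠ 0) (h : ∀ i ∈ s, f i = C * g i) : s.centerMass f b = s.centerMass g b := by
  have h1 : ∑ i ∈ s, f i = C * ∑ i ∈ s, g i := by rw [Finset.mul_sum, Finset.sum_congr rfl h]
  have h2 : ∑ i ∈ s, f i • b i = C • ∑ i ∈ s, g i • b i := by
    rw [Finset.smul_sum]
    exact Finset.sum_congr rfl fun i hi => by rw [h i hi, mul_smul]
  rw [Finset.centerMass, Finset.centerMass, h1, h2, smul_smul, mul_inv, mul_right_comm,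
    inv_mul_cancel₀ hC, one_mul]

theorem sInf_mem_of_nontrivial {s : Finset ℕ} (hs : s.Nontrivial) : sInf (s : Set ℕ) ∈ s := by
  exact_mod_cast Nat.sInf_mem (s := (s : Set ℕ)) hs.nonempty

theorem sSup_mem_of_nontrivial {s : Finset ℕ} (hs : s.Nontrivial) : sSup (s : Set ℕ) ∈ s := by
  exact_mod_cast Nat.sSup_mem (s := (s : Set ℕ)) hs.nonempty s.bddAbove

theorem sInf_le_of_mem {s : Finset ℕ} {a : ℕ} (ha : a ∈ s) : sInf (s : Set ℕ) ≤ a :=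
  Nat.sInf_le (by exact_mod_cast ha)

theorem le_sSup_of_mem {s : Finset ℕ} {a : ℕ} (ha : a ∈ s) : a ≤ sSup (s : Set ℕ) :=
  le_csSup s.bddAbove (by exact_mod_cast ha)

theorem sInf_lt_sSup_of_nontrivial {s : Finset ℕ} (hs : s.Nontrivial) :
    ((sInf (s : Set ℕ) : ℕ) : ℝ) < (sSup (s : Set ℕ) : ℕ) := by
  obtain ⟨k, hk, l, hl, hkl⟩ := hs
  have h1 := sInf_le_of_mem hk
  have h2 := sInf_le_of_mem hl
  have h3 := le_sSup_of_mem hk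
  have h4 := le_sSup_of_mem hl
  have : sInf (s : Set ℕ) < sSup (s : Set ℕ) := by omega
  exact_mod_cast this

/-- The parametrization of a toric curve. -/
def toricPoint (s : Finset ℕ) (c w : ℕ → ℝ) (b : ℕ → E) (x : ℝ) : E :=
  s.centerMass (fun a => w a * toricBasis s c a x) b

theorem toricCurve_eq_image (s : Finset ℕ) (c w : ℕ → ℝ) (b : ℕ → E) :
    toricCurve s c w b = toricPoint s c w b ''
      Set.Icc ((sInf (s : Set ℕ) : ℕ) : ℝ) ((sSup (s : Set ℕ) : ℕ) : ℝ) := rfl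

/-- The monomial parametrization of the dense torus orbit of a toric curve. -/
def torusPoint (s : Finset ℕ) (c w : ℕ → ℝ) (b : ℕ → E) (σ : ℝ) : E :=
  s.centerMass (fun a => w a * c a * σ ^ a) b

/-- With `y = x - a₀` and `z = a₁ - x`, one has `y ^ (a - a₀) * z ^ (a₁ - a) = (z ^ a₁ / y ^ a₀) *
(y / z) ^ a`, and the bracket does not depend on `a`. -/
theorem toricPoint_eq_torusPoint (s : Finset ℕ) (c w : ℕ → ℝ) (b : ℕ → E)
    {x : ℝ} (hx : x ∈ Set.Ioo ((sInf (s : Set ℕ) : ℕ) : ℝ) ((sSup (s : Set ℕ) : ℕ) : ℝ)) :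
    toricPoint s c w b x =
      torusPoint s c w b ((x - (sInf (s : Set ℕ) : ℕ)) / ((sSup (s : Set ℕ) : ℕ) - x)) := by
  have h1 : 0 < x - (sInf (s : Set ℕ) : ℕ) := sub_pos.2 hx.1
  have h2 : 0 < ((sSup (s : Set ℕ) : ℕ) : ℝ) - x := sub_pos.2 hx.2
  set y := x - (sInf (s : Set ℕ) : ℕ) with hy
  set z := ((sSup (s : Set ℕ) : ℕ) : ℝ) - x with hz
  refine centerMass_congr_of_mul (C := z ^ (sSup (s : Set ℕ)) / y ^ (sInf (s : Set ℕ)))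
    (by positivity) fun a ha => ?_
  obtain ⟨i, hi⟩ := Nat.exists_eq_add_of_le (sInf_le_of_mem ha)
  obtain ⟨j, hj⟩ := Nat.exists_eq_add_of_le (le_sSup_of_mem ha)
  rw [toricBasis, ← hy, ← hz]
  have e1 : a - sInf (s : Set ℕ) = i := by omega
  have e2 : sSup (s : Set ℕ) - a = j := by omega
  rw [e1, e2, hj, div_pow, pow_add z a j]
  have e3 : y ^ a = y ^ (sInf (s : Set ℕ)) * y ^ i := by rw [← pow_add, ← hi]
  rw [e3]
  field_simp

theorem torusPoint_mem_toricCurve {s : Finset ℕ} (hs : s.Nontrivial) (c w : ℕ → ℝ) (b : ℕ → E)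
    {σ : ℝ} (hσ : 0 < σ) : torusPoint s c w b σ ∈ toricCurve s c w b := by
  have h := sInf_lt_sSup_of_nontrivial hs
  have h1 : (0 : ℝ) < 1 + σ := by linarith
  set m : ℝ := ((sInf (s : Set ℕ) : ℕ) : ℝ)
  set M : ℝ := ((sSup (s : Set ℕ) : ℕ) : ℝ)
  -- This parameter solves `(x - m) / (M - x) = σ`.
  have hx : (m + σ * M) / (1 + σ) ∈ Set.Ioo m M := by
    constructor
    · rw [lt_div_iff₀ h1]; nlinarith
    · rw [div_lt_iff₀ h1]; nlinarith
  refine ⟨_, Set.Ioo_subset_Icc_self hx, ?_⟩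
  change toricPoint s c w b _ = _
  rw [toricPoint_eq_torusPoint s c w b hx]
  congr 1
  have h2 : M - m ≠ 0 := (sub_pos.2 h).ne'
  have e1 : (m + σ * M) / (1 + σ) - m = σ * (M - m) / (1 + σ) := by field_simp; ring
  have e2 : M - (m + σ * M) / (1 + σ) = (M - m) / (1 + σ) := by field_simp; ring
  change ((m + σ * M) / (1 + σ) - m) / (M - (m + σ * M) / (1 + σ)) = σ
  rw [e1, e2]
  field_simp

theorem sum_toricBasis_pos {s : Finset ℕ} (hs : s.Nontrivial) {c w : ℕ → ℝ}
    (hc : ∀ a ∈ s, 0 < c a) (hw : ∀ a ∈ s, 0 < w a) {x : ℝ}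
    (hx : x ∈ Set.Icc ((sInf (s : Set ℕ) : ℕ) : ℝ) ((sSup (s : Set ℕ) : ℕ) : ℝ)) :
    0 < ∑ a ∈ s, w a * toricBasis s c a x := by
  have h := sInf_lt_sSup_of_nontrivial hs
  have h1 : 0 ≤ x - (sInf (s : Set ℕ) : ℕ) := sub_nonneg.2 hx.1
  have h2 : 0 ≤ ((sSup (s : Set ℕ) : ℕ) : ℝ) - x := sub_nonneg.2 hx.2
  have hnn : ∀ a ∈ s, 0 ≤ w a * toricBasis s c a x := fun a ha => by
    have := hc a ha
    have := hw a ha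
    unfold toricBasis
    positivity
  -- At the right end the basis function of `max s` is positive; everywhere else that of `min s` is,
  -- being a multiple of a power of `max s - x`.
  rcases h2.eq_or_lt with h0 | h0
  · refine Finset.sum_pos' hnn ⟨_, sSup_mem_of_nontrivial hs, ?_⟩
    have := hc _ (sSup_mem_of_nontrivial hs)
    have := hw _ (sSup_mem_of_nontrivial hs)
    have h3 : 0 < x - (sInf (s : Set ℕ) : ℕ) := by linarith
    rw [toricBasis, Nat.sub_self, pow_zero, mul_one]
    positivity
  · refine Finset.sum_pos' hnn ⟨_, sInf_mem_of_nontrivial hs, ?_⟩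
    have := hc _ (sInf_mem_of_nontrivial hs)
    have := hw _ (sInf_mem_of_nontrivial hs)
    rw [toricBasis, Nat.sub_self, pow_zero, mul_one]
    positivity

theorem continuousOn_toricPoint {s : Finset ℕ} (hs : s.Nontrivial) {c w : ℕ → ℝ} (b : ℕ → E)
    (hc : ∀ a ∈ s, 0 < c a) (hw : ∀ a ∈ s, 0 < w a) :
    ContinuousOn (toricPoint s c w b)
      (Set.Icc ((sInf (s : Set ℕ) : ℕ) : ℝ) ((sSup (s : Set ℕ) : ℕ) : ℝ)) := by
  unfold toricPoint Finset.centerMass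
  refine ContinuousOn.smul (ContinuousOn.inv₀ ?_ fun x hx => (sum_toricBasis_pos hs hc hw hx).ne') ?_
  · unfold toricBasis
    fun_prop
  · unfold toricBasis
    fun_prop

theorem isCompact_toricCurve {s : Finset ℕ} (hs : s.Nontrivial) {c w : ℕ → ℝ} (b : ℕ → E)
    (hc : ∀ a ∈ s, 0 < c a) (hw : ∀ a ∈ s, 0 < w a) : IsCompact (toricCurve s c w b) :=
  isCompact_Icc.image_of_continuousOn (continuousOn_toricPoint hs b hc hw)

/-- The open parameter interval is dense in the closed one. Distance estimates can therefore be made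
in the monomial parameter `σ > 0` alone. -/
theorem toricCurve_subset_closure {s : Finset ℕ} (hs : s.Nontrivial) {c w : ℕ → ℝ} (b : ℕ → E)
    (hc : ∀ a ∈ s, 0 < c a) (hw : ∀ a ∈ s, 0 < w a) :
    toricCurve s c w b ⊆ closure (torusPoint s c w b '' Set.Ioi 0) := by
  have h := sInf_lt_sSup_of_nontrivial hs
  rw [toricCurve_eq_image, ← closure_Ioo h.ne]
  refine ((continuousOn_toricPoint hs b hc hw).mono
    (closure_Ioo h.ne).subset).image_closure.trans (closure_mono ?_)
  rintro _ ⟨x, hx, rfl⟩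
  exact ⟨_, div_pos (sub_pos.2 hx.1) (sub_pos.2 hx.2), (toricPoint_eq_torusPoint s c w b hx).symm⟩

/-- At the left end of the parameter interval every other basis function vanishes. This and its
mirror image serve the limit points that are single control points. -/
theorem sInf_point_mem_toricCurve {s : Finset ℕ} (hs : s.Nontrivial) {c w : ℕ → ℝ} (b : ℕ → E)
    (hc : ∀ a ∈ s, 0 < c a) (hw : ∀ a ∈ s, 0 < w a) :
    b (sInf (s : Set ℕ)) ∈ toricCurve s c w b := by
  have h := sInf_lt_sSup_of_nontrivial hs
  have hm := sInf_mem_of_nontrivial hs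
  refine ⟨_, Set.left_mem_Icc.2 h.le, ?_⟩
  change s.centerMass _ b = _
  rw [← Finset.centerMass_subset b (Finset.singleton_subset_iff.2 hm), Finset.centerMass_singleton]
  · have := hc _ hm
    have := hw _ hm
    have := sub_pos.2 h
    rw [toricBasis, Nat.sub_self, pow_zero, mul_one]
    positivity
  · intro a ha hne
    rw [Finset.mem_singleton] at hne
    have := sInf_le_of_mem ha
    rw [toricBasis, sub_self, zero_pow (by omega)]
    simp

theorem sSup_point_mem_toricCurve {s : Finset ℕ} (hs : s.Nontrivial) {c w : ℕ → ℝ} (b : ℕ → E)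
    (hc : ∀ a ∈ s, 0 < c a) (hw : ∀ a ∈ s, 0 < w a) :
    b (sSup (s : Set ℕ)) ∈ toricCurve s c w b := by
  have h := sInf_lt_sSup_of_nontrivial hs
  have hm := sSup_mem_of_nontrivial hs
  refine ⟨_, Set.right_mem_Icc.2 h.le, ?_⟩
  change s.centerMass _ b = _
  rw [← Finset.centerMass_subset b (Finset.singleton_subset_iff.2 hm), Finset.centerMass_singleton]
  · have := hc _ hm
    have := hw _ hm
    have := sub_pos.2 h
    rw [toricBasis, Nat.sub_self, pow_zero, mul_one]
    positivity
  · intro a ha hne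
    rw [Finset.mem_singleton] at hne
    have := le_sSup_of_mem ha
    rw [toricBasis, sub_self, zero_pow (by omega)]
    simp

end Toric

/-! ### Toric degeneration of a single rational Bézier curve -/

section Degeneration

variable {E : Type*} [NormedAddCommGroup E] [NormedSpace ℝ E]

/-- Every point of the torus orbit of an upper face is a limit of points of the curves with lifted
weights. -/
theorem tendsto_torusPoint_of_upperFace {A : Finset ℕ} {c : ℕ → ℝ} (hc : ∀ a ∈ A, 0 < c a)
    {lam ω : ℕ → ℝ} (hω : ∀ a ∈ A, 0 < ω a) {W : ℝ → ℕ → ℝ} {Q : ℝ → ℕ → E} {Q₀ : ℕ → E}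
    (hW : ∀ a ∈ A, Tendsto (fun t => t ^ (-lam a) * W t a) atTop (𝓝 (ω a)))
    (hQ : ∀ a ∈ A, Tendsto (fun t => Q t a) atTop (𝓝 (Q₀ a))) {θ : ℝ}
    (hne : (upperFace A lam θ).Nonempty) {σ : ℝ} (hσ : 0 < σ) :
    Tendsto (fun t : ℝ => torusPoint A c (W t) (Q t) (σ * t ^ θ)) atTop
      (𝓝 (torusPoint (upperFace A lam θ) c ω Q₀ σ)) := by
  classical
  obtain ⟨k, hk⟩ := hne
  have hsub : upperFace A lam θ ⊆ A := fun a ha => (mem_upperFace.1 ha).1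
  have hlim : torusPoint (upperFace A lam θ) c ω Q₀ σ = A.centerMass
      (fun a => if a ∈ upperFace A lam θ then ω a * c a * σ ^ a else 0) Q₀ := by
    rw [← Finset.centerMass_subset Q₀ hsub]
    · exact centerMass_congr_of_mul one_ne_zero fun i hi => by simp [hi]
    · intro i _ hi
      simp [hi]
  rw [hlim]
  -- Normalizing by the maximum `λ(k) + θ k` makes all exponents of `t` nonpositive, with zero
  -- exactly on the face.
  have hscale : ∀ᶠ t : ℝ in atTop, A.centerMass
      (fun a => (t ^ (-lam a) * W t a) * t ^ (lam a + θ * a - (lam k + θ * k)) * c a * σ ^ a)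
        (Q t) = torusPoint A c (W t) (Q t) (σ * t ^ θ) := by
    filter_upwards [eventually_gt_atTop 0] with t ht
    refine centerMass_congr_of_mul (C := t ^ (-(lam k + θ * k))) (Real.rpow_pos_of_pos ht _).ne' ?_
    intro a _
    have e1 : (t ^ θ) ^ a = t ^ (θ * a) := by rw [Real.rpow_mul ht.le, Real.rpow_natCast]
    have e2 : t ^ (-lam a) * t ^ (lam a + θ * a - (lam k + θ * k)) =
        t ^ (-(lam k + θ * k)) * t ^ (θ * a) := by
      rw [← Real.rpow_add ht, ← Real.rpow_add ht]
      congr 1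
      ring
    rw [mul_pow, e1]
    linear_combination (W t a * c a * σ ^ a) * e2
  refine Tendsto.congr' hscale (tendsto_centerMass ?_ hQ ?_)
  · intro a ha
    have hpow : Tendsto (fun t : ℝ => t ^ (lam a + θ * a - (lam k + θ * k))) atTop
        (𝓝 (if a ∈ upperFace A lam θ then 1 else 0)) := by
      have hle := (mem_upperFace.1 hk).2 a ha
      split_ifs with hface
      · have : lam a + θ * a - (lam k + θ * k) = 0 := by
          linarith [(mem_upperFace.1 hface).2 k (hsub hk)]
        rw [this]
        simp
      · have hlt : lam a + θ * a < lam k + θ * k := by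
          refine lt_of_le_of_ne hle fun heq => hface (mem_upperFace.2 ⟨ha, ?_⟩)
          rw [heq]
          exact (mem_upperFace.1 hk).2
        have := tendsto_rpow_neg_atTop (y := lam k + θ * k - (lam a + θ * a)) (by linarith)
        simpa using this
    have := (((hW a ha).mul hpow).mul_const (c a)).mul_const (σ ^ a)
    refine this.congr' (Eventually.of_forall fun t => rfl) |>.trans (le_of_eq ?_)
    congr 1
    split_ifs <;> simp
  · refine (Finset.sum_pos' (fun a ha => ?_) ⟨k, hsub hk, ?_⟩).ne'
    · have := hc a ha
      have := hω a ha
      split_ifs <;> positivity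
    · have := hc k (hsub hk)
      have := hω k (hsub hk)
      rw [if_pos hk]
      positivity

/-- Every limit point of points of the curves with lifted weights lies on the union of the curves
of the regular decomposition. -/
theorem exists_tendsto_torusPoint {A : Finset ℕ} (hA : A.Nontrivial) {c : ℕ → ℝ}
    (hc : ∀ a ∈ A, 0 < c a)
    {lam ω : ℕ → ℝ} (hω : ∀ a ∈ A, 0 < ω a) {W : ℝ → ℕ → ℝ} {Q : ℝ → ℕ → E} {Q₀ : ℕ → E}
    (hW : ∀ a ∈ A, Tendsto (fun t => t ^ (-lam a) * W t a) atTop (𝓝 (ω a)))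
    (hQ : ∀ a ∈ A, Tendsto (fun t => Q t a) atTop (𝓝 (Q₀ a)))
    (𝒰 : Ultrafilter ℝ) (h𝒰 : (𝒰 : Filter ℝ) ≤ atTop) {τ : ℝ → ℝ} (hτ : ∀ t, 0 < τ t) :
    ∃ y ∈ ⋃ s ∈ regularDecomposition A lam, toricCurve s c ω Q₀,
      Tendsto (fun t => torusPoint A c (W t) (Q t) (τ t)) 𝒰 (𝓝 y) := by
  classical
  set r : ℕ → ℝ → ℝ := fun k t => c k * t ^ lam k * τ t ^ k with hr
  have hpos : ∀ᶠ t : ℝ in (𝒰 : Filter ℝ), 1 < t := h𝒰 (eventually_gt_atTop 1)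
  have hrpos : ∀ t : ℝ, 1 < t → ∀ k ∈ A, 0 < r k t := fun t ht k hk => by
    have h1 := hc k hk
    have h2 := hτ t
    have h3 : 0 < t ^ lam k := Real.rpow_pos_of_pos (by linarith) _
    simp only [hr]
    positivity
  -- The index of the largest term depends on `t`, but along an ultrafilter one of the finitely many
  -- candidates is largest throughout.
  obtain ⟨k, hk, hmax⟩ : ∃ k ∈ (A : Set ℕ), ∀ᶠ t in (𝒰 : Filter ℝ), ∀ l ∈ A, r l t ≤ r k t := by
    rw [← Ultrafilter.eventually_exists_mem_iff A.finite_toSet]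
    exact Eventually.of_forall fun t => A.exists_max_image (fun l => r l t) hA.nonempty
  rw [Finset.mem_coe] at hk
  set q : ℕ → ℝ → ℝ := fun l t => r l t / r k t with hq
  have hqmem : ∀ l ∈ A, ∀ᶠ t in (𝒰 : Filter ℝ), q l t ∈ Set.Icc (0 : ℝ) 1 := by
    intro l hl
    filter_upwards [hpos, hmax] with t ht hm
    exact ⟨(div_pos (hrpos t ht l hl) (hrpos t ht k hk)).le,
      (div_le_one (hrpos t ht k hk)).2 (hm l hl)⟩
  have hex : ∀ l, ∃ ρ, l ∈ A → 0 ≤ ρ ∧ Tendsto (q l) 𝒰 (𝓝 ρ) := by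
    intro l
    by_cases hl : l ∈ A
    · obtain ⟨ρ, hρ, hlim⟩ := (isCompact_Icc (a := (0 : ℝ)) (b := 1)).ultrafilter_le_nhds
        (𝒰.map (q l)) (by rw [le_principal_iff]; exact hqmem l hl)
      exact ⟨ρ, fun _ => ⟨hρ.1, hlim⟩⟩
    · exact ⟨0, fun h => absurd h hl⟩
  choose ρ hρ using hex
  have hρk : ρ k = 1 := by
    refine tendsto_nhds_unique (hρ k hk).2 (tendsto_const_nhds.congr' ?_)
    filter_upwards [hpos] with t ht
    exact (div_self (hrpos t ht k hk).ne').symm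
  have hlim : Tendsto (fun t => torusPoint A c (W t) (Q t) (τ t)) 𝒰
      (𝓝 (A.centerMass (fun a => ω a * ρ a) Q₀)) := by
    have hscale : ∀ᶠ t : ℝ in (𝒰 : Filter ℝ), A.centerMass
        (fun a => (t ^ (-lam a) * W t a) * q a t) (Q t) = torusPoint A c (W t) (Q t) (τ t) := by
      filter_upwards [hpos] with t ht
      refine centerMass_congr_of_mul (C := (r k t)⁻¹) (inv_ne_zero (hrpos t ht k hk).ne') ?_
      intro a _
      have e : t ^ (-lam a) * t ^ lam a = 1 := by
        rw [← Real.rpow_add (by linarith), neg_add_cancel, Real.rpow_zero]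
      simp only [hq, div_eq_mul_inv]
      change t ^ (-lam a) * W t a * (c a * t ^ lam a * τ t ^ a * (r k t)⁻¹) = _
      linear_combination (W t a * c a * τ t ^ a * (r k t)⁻¹) * e
    refine Tendsto.congr' hscale (tendsto_centerMass
      (fun a ha => ((hW a ha).mono_left h𝒰).mul (hρ a ha).2)
      (fun a ha => (hQ a ha).mono_left h𝒰) ?_)
    refine (Finset.sum_pos' (fun a ha => mul_nonneg (hω a ha).le (hρ a ha).1) ⟨k, hk, ?_⟩).ne'
    rw [hρk, mul_one]
    exact hω k hk
  refine ⟨_, ?_, hlim⟩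
  have hlogq : ∀ t : ℝ, 1 < t → ∀ l ∈ A, Real.log (q l t) = Real.log (c l) - Real.log (c k) +
      (lam l - lam k) * Real.log t + ((l : ℝ) - k) * Real.log (τ t) := by
    intro t ht l hl
    have ht0 : (0 : ℝ) < t := by linarith
    have h3 : ∀ j, (t ^ lam j : ℝ) ≠ 0 := fun j => (Real.rpow_pos_of_pos ht0 _).ne'
    have h4 : ∀ j : ℕ, τ t ^ j ≠ 0 := fun j => pow_ne_zero _ (hτ t).ne'
    have h5 : ∀ j ∈ A, Real.log (r j t) =
        Real.log (c j) + lam j * Real.log t + j * Real.log (τ t) := by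
      intro j hj
      simp only [hr]
      rw [Real.log_mul (mul_ne_zero (hc j hj).ne' (h3 j)) (h4 j),
        Real.log_mul (hc j hj).ne' (h3 j), Real.log_rpow ht0, Real.log_pow]
    simp only [hq]
    rw [Real.log_div (hrpos t ht l hl).ne' (hrpos t ht k hk).ne', h5 l hl, h5 k hk]
    ring
  by_cases hother : ∃ l ∈ A, l ≠ k ∧ ρ l ≠ 0
  · obtain ⟨l, hl, hlk, hρl⟩ := hother
    have hd : (l : ℝ) - k ≠ 0 := sub_ne_zero.2 (by exact_mod_cast hlk)
    -- The tie between `k` and `l` fixes this slope. Then `log (q l t)` involves `t` only through `η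
    -- t`, so `η`, the logarithm of `τ t / t ^ θ`, converges.
    set θ : ℝ := -(lam l - lam k) / ((l : ℝ) - k) with hθ
    have hθl : (lam l - lam k) + θ * ((l : ℝ) - k) = 0 := by
      rw [hθ, div_mul_cancel₀ _ hd]
      ring
    set η : ℝ → ℝ := fun t => Real.log (τ t) - θ * Real.log t with hη
    obtain ⟨η₀, hη₀⟩ : ∃ η₀, Tendsto η 𝒰 (𝓝 η₀) := by
      refine ⟨(Real.log (ρ l) - (Real.log (c l) - Real.log (c k))) / ((l : ℝ) - k), ?_⟩
      refine Tendsto.congr' ?_ ((((hρ l hl).2.log hρl).sub_const _).div_const _)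
      filter_upwards [hpos] with t ht
      rw [hlogq t ht l hl, div_eq_iff hd]
      simp only [hη]
      linear_combination Real.log t * hθl
    have hlogη : ∀ t : ℝ, 1 < t → ∀ j ∈ A, Real.log (q j t) = Real.log (c j) - Real.log (c k) +
        (lam j - lam k + θ * ((j : ℝ) - k)) * Real.log t + ((j : ℝ) - k) * η t := by
      intro t ht j hj
      rw [hlogq t ht j hj]
      simp only [hη]
      ring
    have hlogt : Tendsto Real.log (𝒰 : Filter ℝ) atTop := Real.tendsto_log_atTop.mono_left h𝒰
    -- A larger value at `j` would send `q j` to infinity, although it stays in `[0, 1]`.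
    have hmaxk : ∀ j ∈ A, lam j + θ * j ≤ lam k + θ * k := by
      intro j hj
      by_contra hcon
      have hD : 0 < lam j - lam k + θ * ((j : ℝ) - k) := by linarith [not_le.1 hcon]
      have h1 : Tendsto (fun t => Real.log (q j t)) 𝒰 atTop := by
        have h2 := (tendsto_atTop_add_const_left _ (Real.log (c j) - Real.log (c k))
          (hlogt.const_mul_atTop hD)).atTop_add (hη₀.const_mul ((j : ℝ) - k))
        refine h2.congr' ?_
        filter_upwards [hpos] with t ht
        rw [hlogη t ht j hj]
      obtain ⟨t, h2, h3⟩ := ((h1.eventually_gt_atTop 0).and (hqmem j hj)).exists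
      exact absurd (Real.log_nonpos h3.1 h3.2) (not_le.2 h2)
    have hkf : k ∈ upperFace A lam θ := mem_upperFace.2 ⟨hk, hmaxk⟩
    have hlf : l ∈ upperFace A lam θ := mem_upperFace.2 ⟨hl, by
      have : lam l + θ * l = lam k + θ * k := by linarith
      rw [this]
      exact hmaxk⟩
    have hnt : (upperFace A lam θ).Nontrivial := ⟨k, hkf, l, hlf, hlk.symm⟩
    refine Set.mem_biUnion (mem_regularDecomposition_iff.2 ⟨hnt, θ, rfl⟩) ?_
    have hqexp : ∀ t : ℝ, 1 < t → ∀ j ∈ A, q j t = c j / c k *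
        Real.exp ((lam j - lam k + θ * ((j : ℝ) - k)) * Real.log t + ((j : ℝ) - k) * η t) := by
      intro t ht j hj
      have hqpos : 0 < q j t := div_pos (hrpos t ht j hj) (hrpos t ht k hk)
      rw [← Real.exp_log hqpos, hlogη t ht j hj, add_assoc, Real.exp_add, Real.exp_sub,
        Real.exp_log (hc j hj), Real.exp_log (hc k hk)]
    have hρface : ∀ j ∈ upperFace A lam θ,
        ω j * ρ j = (c k * Real.exp η₀ ^ k)⁻¹ * (ω j * c j * Real.exp η₀ ^ j) := by
      intro j hj
      have hjA := (mem_upperFace.1 hj).1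
      have hD : lam j - lam k + θ * ((j : ℝ) - k) = 0 := by
        linarith [(mem_upperFace.1 hj).2 k hk, hmaxk j hjA]
      have h1 : ρ j = c j / c k * Real.exp (((j : ℝ) - k) * η₀) := by
        refine tendsto_nhds_unique (hρ j hjA).2 ?_
        refine Tendsto.congr' ?_ (((Real.continuous_exp.tendsto _).comp
          (hη₀.const_mul ((j : ℝ) - k))).const_mul (c j / c k))
        filter_upwards [hpos] with t ht
        rw [hqexp t ht j hjA, hD, zero_mul, zero_add]
        rfl
      have h2 : Real.exp (((j : ℝ) - k) * η₀) = Real.exp η₀ ^ j / Real.exp η₀ ^ k := by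
        rw [← Real.exp_nat_mul, ← Real.exp_nat_mul, ← Real.exp_sub, sub_mul]
      have := (hc k hk).ne'
      rw [h1, h2]
      field_simp
    have hρout : ∀ j ∈ A, j ∉ upperFace A lam θ → ω j * ρ j = 0 := by
      intro j hjA hj
      have hD : lam j - lam k + θ * ((j : ℝ) - k) < 0 := by
        have : lam j + θ * j < lam k + θ * k := by
          refine lt_of_le_of_ne (hmaxk j hjA) fun heq => hj (mem_upperFace.2 ⟨hjA, ?_⟩)
          rw [heq]
          exact hmaxk
        linarith
      have h1 : ρ j = 0 := by
        refine tendsto_nhds_unique (hρ j hjA).2 ?_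
        have h2 : Tendsto (fun t => (lam j - lam k + θ * ((j : ℝ) - k)) * Real.log t +
            ((j : ℝ) - k) * η t) 𝒰 atBot :=
          (hlogt.const_mul_atTop_of_neg hD).atBot_add (hη₀.const_mul ((j : ℝ) - k))
        have h3 := (Real.tendsto_exp_atBot.comp h2).const_mul (c j / c k)
        rw [mul_zero] at h3
        refine h3.congr' ?_
        filter_upwards [hpos] with t ht
        rw [hqexp t ht j hjA]
        rfl
      rw [h1, mul_zero]
    have hsub : upperFace A lam θ ⊆ A := fun a ha => (mem_upperFace.1 ha).1
    rw [← Finset.centerMass_subset Q₀ hsub hρout,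
      centerMass_congr_of_mul (inv_ne_zero (mul_ne_zero (hc k hk).ne'
        (pow_ne_zero _ (Real.exp_pos η₀).ne'))) hρface]
    exact torusPoint_mem_toricCurve hnt c ω Q₀ (Real.exp_pos η₀)
  · push Not at hother
    have hy : A.centerMass (fun a => ω a * ρ a) Q₀ = Q₀ k := by
      rw [← Finset.centerMass_subset Q₀ (Finset.singleton_subset_iff.2 hk),
        Finset.centerMass_singleton]
      · rw [hρk, mul_one]
        exact (hω k hk).ne'
      · intro i hi hik
        rw [hother i hi (by simpa using hik), mul_zero]
    rw [hy]
    -- The other ratios tend to zero, so at a single large `t` all lie below `c l / c k`. Taking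
    -- logarithms there cancels the constants and makes `k` the strict maximum for the slope `log τ
    -- / log t`.
    have hsmall : ∀ l ∈ A, ∀ᶠ t in (𝒰 : Filter ℝ), l ≠ k → q l t < c l / c k := by
      intro l hl
      by_cases hlk : l = k
      · exact Eventually.of_forall fun _ h => absurd hlk h
      · have h1 := (hρ l hl).2
        rw [hother l hl hlk] at h1
        filter_upwards [h1.eventually_lt_const (div_pos (hc l hl) (hc k hk))] with t ht _
        exact ht
    obtain ⟨t, ht, hqt⟩ := (hpos.and ((Filter.eventually_all_finset A).2 hsmall)).exists
    obtain ⟨s, hs, hks, hend⟩ := exists_mem_regularDecomposition_of_strict_max hA hk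
      (lam := lam) (Real.log (τ t) / Real.log t) (by
        intro l hl hlk
        have hlog : 0 < Real.log t := Real.log_pos ht
        have h1 := Real.log_lt_log (div_pos (hrpos t ht l hl) (hrpos t ht k hk)) (hqt l hl hlk)
        change Real.log (q l t) < _ at h1
        rw [hlogq t ht l hl, Real.log_div (hc l hl).ne' (hc k hk).ne'] at h1
        have e : Real.log (τ t) = Real.log (τ t) / Real.log t * Real.log t := by
          rw [div_mul_cancel₀ _ hlog.ne']
        rw [e] at h1
        by_contra hcon
        rw [not_lt] at hcon
        have h2 := mul_le_mul_of_nonneg_right hcon hlog.le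
        linarith)
    refine Set.mem_biUnion hs ?_
    obtain ⟨hnt, θ, hθ⟩ := mem_regularDecomposition_iff.1 hs
    have hsA : ∀ a ∈ s, a ∈ A := fun a ha => by
      rw [hθ] at ha
      exact (mem_upperFace.1 ha).1
    rcases hend with hend | hend
    · have e : sInf (s : Set ℕ) = k :=
        le_antisymm (sInf_le_of_mem hks) (hend _ (sInf_mem_of_nontrivial hnt))
      rw [← e]
      exact sInf_point_mem_toricCurve hnt Q₀ (fun a ha => hc a (hsA a ha))
        fun a ha => hω a (hsA a ha)
    · have e : sSup (s : Set ℕ) = k :=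
        le_antisymm (hend _ (sSup_mem_of_nontrivial hnt)) (le_sSup_of_mem hks)
      rw [← e]
      exact sSup_point_mem_toricCurve hnt Q₀ (fun a ha => hc a (hsA a ha))
        fun a ha => hω a (hsA a ha)

/-- Toric degeneration of curves: the curves with the weights `t ^ λ(k) (ω_k + o(1))` converge to
the union of the curves of the regular decomposition induced by `λ`. -/
theorem tendsto_hausdorffEDist_toricCurve {A : Finset ℕ} (hA : A.Nontrivial) {c : ℕ → ℝ}
    (hc : ∀ a ∈ A, 0 < c a)
    {lam ω : ℕ → ℝ} (hω : ∀ a ∈ A, 0 < ω a) {W : ℝ → ℕ → ℝ} {Q : ℝ → ℕ → E} {Q₀ : ℕ → E}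
    (hWpos : ∀ t > 0, ∀ a ∈ A, 0 < W t a)
    (hW : ∀ a ∈ A, Tendsto (fun t => t ^ (-lam a) * W t a) atTop (𝓝 (ω a)))
    (hQ : ∀ a ∈ A, Tendsto (fun t => Q t a) atTop (𝓝 (Q₀ a))) :
    Tendsto (fun t => Metric.hausdorffEDist (toricCurve A c (W t) (Q t))
      (⋃ s ∈ regularDecomposition A lam, toricCurve s c ω Q₀)) atTop (𝓝 0) := by
  set C := ⋃ s ∈ regularDecomposition A lam, toricCurve s c ω Q₀ with hC
  have hmemA : ∀ s ∈ regularDecomposition A lam, ∀ a ∈ s, a ∈ A := fun s hs a ha => by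
    obtain ⟨-, θ, hθ⟩ := mem_regularDecomposition_iff.1 hs
    rw [hθ] at ha
    exact (mem_upperFace.1 ha).1
  have hcomp : IsCompact C := (regularDecomposition_finite A lam).isCompact_biUnion fun s hs =>
    isCompact_toricCurve (mem_regularDecomposition_iff.1 hs).1 Q₀
      (fun a ha => hc a (hmemA s hs a ha)) fun a ha => hω a (hmemA s hs a ha)
  have hupper : ∀ ε : ENNReal, 0 < ε → ∀ᶠ t : ℝ in atTop, ∀ τ > 0,
      Metric.infEDist (torusPoint A c (W t) (Q t) τ) C ≤ ε := by
    intro ε hε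
    by_contra hcon
    set bad : Set ℝ := {t | ∃ τ > 0, ε < Metric.infEDist (torusPoint A c (W t) (Q t) τ) C} with hbad
    have hfreq : ∃ᶠ t in atTop, t ∈ bad := by
      refine (not_eventually.1 hcon).mono fun t ht => ?_
      push Not at ht
      exact ht
    -- At a bad `t` the parameter witnesses the failure; elsewhere the value `1` is arbitrary. The
    -- ultrafilter chosen below lives on the bad set, where the distance cannot tend to zero.
    have hex : ∀ t : ℝ, ∃ τ : ℝ, 0 < τ ∧
        (t ∈ bad → ε < Metric.infEDist (torusPoint A c (W t) (Q t) τ) C) := by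
      intro t
      by_cases ht : t ∈ bad
      · obtain ⟨τ, h1, h2⟩ := ht
        exact ⟨τ, h1, fun _ => h2⟩
      · exact ⟨1, one_pos, fun h => absurd h ht⟩
    choose τ hτ hτbad using hex
    have : NeBot (atTop ⊓ 𝓟 bad) := frequently_mem_iff_neBot.1 hfreq
    have h𝒰 : (Ultrafilter.of (atTop ⊓ 𝓟 bad) : Filter ℝ) ≤ atTop ⊓ 𝓟 bad := Ultrafilter.of_le _
    obtain ⟨y, hy, hlim⟩ := exists_tendsto_torusPoint hA hc hω hW hQ
      (Ultrafilter.of (atTop ⊓ 𝓟 bad)) (h𝒰.trans inf_le_left) hτ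
    have h1 := (Metric.continuous_infEDist (s := C)).continuousAt.tendsto.comp hlim
    rw [Metric.infEDist_zero_of_mem hy] at h1
    have h2 : ∀ᶠ t in (Ultrafilter.of (atTop ⊓ 𝓟 bad) : Filter ℝ), t ∈ bad :=
      (h𝒰.trans inf_le_right) (mem_principal_self bad)
    obtain ⟨t, h3, h4⟩ := ((h1.eventually_lt_const hε).and h2).exists
    exact absurd (hτbad t h4) (not_lt.2 h3.le)
  have hpoint : ∀ ε : ENNReal, 0 < ε → ∀ y ∈ C, ∀ᶠ t : ℝ in atTop,
      Metric.infEDist y (toricCurve A c (W t) (Q t)) < ε := by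
    intro ε hε y hy
    obtain ⟨s, hs, hys⟩ := Set.mem_iUnion₂.1 hy
    obtain ⟨hnt, θ, hθ⟩ := mem_regularDecomposition_iff.1 hs
    have h1 := toricCurve_subset_closure hnt Q₀ (fun a ha => hc a (hmemA s hs a ha))
      (fun a ha => hω a (hmemA s hs a ha)) hys
    have hε2 : 0 < ε / 2 := ENNReal.half_pos hε.ne'
    obtain ⟨_, ⟨σ, hσ, rfl⟩, hyσ⟩ := EMetric.mem_closure_iff.1 h1 (ε / 2) hε2
    have h2 := tendsto_torusPoint_of_upperFace hc hω hW hQ (θ := θ) (hθ ▸ hnt.nonempty) hσ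
    rw [← hθ] at h2
    filter_upwards [(EMetric.tendsto_nhds.1 h2) (ε / 2) hε2, eventually_gt_atTop 0] with t ht ht0
    refine Metric.infEDist_lt_iff.2 ⟨_, torusPoint_mem_toricCurve hA c (W t) (Q t)
      (mul_pos hσ (Real.rpow_pos_of_pos ht0 θ)), ?_⟩
    calc _ ≤ _ := edist_triangle _ (torusPoint s c ω Q₀ σ) _
      _ < ε / 2 + ε / 2 := by
        rw [edist_comm] at ht
        exact ENNReal.add_lt_add hyσ ht
      _ = ε := ENNReal.add_halves ε
  have hlower : ∀ ε : ENNReal, 0 < ε → ∀ᶠ t : ℝ in atTop, ∀ y ∈ C,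
      Metric.infEDist y (toricCurve A c (W t) (Q t)) ≤ ε := by
    intro ε hε
    have hε2 : 0 < ε / 2 := ENNReal.half_pos hε.ne'
    -- Total boundedness of the limit upgrades the pointwise approximation to a uniform one.
    obtain ⟨F, hFC, hF, hcov⟩ := EMetric.totallyBounded_iff'.1 hcomp.totallyBounded (ε / 2) hε2
    have h1 := (Filter.eventually_all_finite hF).2 fun y hy => hpoint (ε / 2) hε2 y (hFC hy)
    filter_upwards [h1] with t ht y hy
    obtain ⟨z, hz, hyz⟩ := Set.mem_iUnion₂.1 (hcov hy)
    calc _ ≤ _ := Metric.infEDist_le_edist_add_infEDist (y := z)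
      _ ≤ ε / 2 + ε / 2 := add_le_add (Metric.mem_eball.1 hyz).le (ht z hz).le
      _ = ε := ENNReal.add_halves ε
  rw [ENNReal.tendsto_nhds_zero]
  intro ε hε
  filter_upwards [hupper ε hε, hlower ε hε, eventually_gt_atTop 0] with t h1 h2 ht
  refine Metric.hausdorffEDist_le_of_infEDist (fun x hx => ?_) h2
  have hx' := toricCurve_subset_closure hA (Q t) hc (hWpos t ht) hx
  have hclosed : IsClosed {x | Metric.infEDist x C ≤ ε} :=
    isClosed_le Metric.continuous_infEDist continuous_const
  refine closure_minimal ?_ hclosed hx'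
  rintro _ ⟨τ, hτ, rfl⟩
  exact h1 τ hτ

end Degeneration

/-! ### Boehm's knot insertion -/

section Boehm

theorem bsplineBasis_congr {U V : ℕ → ℝ} (y : ℝ) (q : ℕ) :
    ∀ i i', (∀ j ≤ q + 1, U (i + j) = V (i' + j)) →
      bsplineBasis U q i y = bsplineBasis V q i' y := by
  induction q with
  | zero =>
    intro i i' h
    have h0 := h 0 (by omega)
    have h1 := h 1 (by omega)
    rw [add_zero, add_zero] at h0
    simp only [bsplineBasis, h0, h1]
  | succ q ih =>
    intro i i' h
    have h0 := h 0 (by omega)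
    have h1 := h 1 (by omega)
    have h2 := h (q + 1) (by omega)
    have h3 := h (q + 2) (by omega)
    rw [add_zero, add_zero] at h0
    simp only [← add_assoc] at h2 h3
    have e1 := ih i i' fun j hj => h j (by omega)
    have e2 := ih (i + 1) (i' + 1) fun j hj => by
      have := h (1 + j) (by omega)
      rwa [← add_assoc, ← add_assoc] at this
    simp only [bsplineBasis]
    rw [e1, e2, h0, h1, h2, h3]

/-- A B-spline with degenerate support vanishes under the convention `0 / 0 = 0`. This disposes of
the vanishing denominators in the comparison of coefficients below. -/
theorem bsplineBasis_eq_zero_of_eq {U : ℕ → ℝ} (hU : Monotone U) (y : ℝ) (q : ℕ) :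
    ∀ i, U i = U (i + q + 1) → bsplineBasis U q i y = 0 := by
  induction q with
  | zero =>
    intro i h
    simp only [bsplineBasis]
    rw [add_zero] at h
    rw [if_neg]
    rw [← h]
    rintro (⟨h1, h2⟩ | ⟨-, h2, h3⟩) <;> linarith
  | succ q ih =>
    intro i h
    have h1 : U i ≤ U (i + 1) := hU (by omega)
    have h2 : U (i + 1) ≤ U (i + q + 1) := hU (by omega)
    have h3 : U (i + q + 1) ≤ U (i + (q + 1) + 1) := hU (by omega)
    have e : i + 1 + q + 1 = i + (q + 1) + 1 := by omega
    simp only [bsplineBasis]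
    rw [ih i (by linarith), ih (i + 1) (by rw [e]; linarith)]
    simp

variable {U : ℕ → ℝ} {x : ℝ} {s : ℕ}

/-- The hypothesis `hs` locates `x`: for nondecreasing `U` it says `U s ≤ x < U (s + 1)`. -/
theorem insertKnot_of_le (hs : ∀ j, U j ≤ x ↔ j ≤ s) {j : ℕ} (hj : j ≤ s) :
    insertKnot U x j = U j :=
  if_pos ((hs j).2 hj)

theorem insertKnot_self (hs : ∀ j, U j ≤ x ↔ j ≤ s) : insertKnot U x (s + 1) = x := by
  rw [insertKnot, if_neg (by rw [hs]; omega), if_pos (by rw [hs]; omega)]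

theorem insertKnot_of_lt (hs : ∀ j, U j ≤ x ↔ j ≤ s) {j : ℕ} (hj : s < j) :
    insertKnot U x (j + 1) = U j := by
  rw [insertKnot, if_neg (by rw [hs]; omega), if_neg (by rw [hs]; omega), Nat.add_sub_cancel]

theorem monotone_insertKnot (hU : Monotone U) (hs : ∀ j, U j ≤ x ↔ j ≤ s) :
    Monotone (insertKnot U x) := by
  refine monotone_nat_of_le_succ fun j => ?_
  rcases lt_trichotomy j s with h | rfl | h
  · rw [insertKnot_of_le hs h.le, insertKnot_of_le hs (by omega)]
    exact hU (by omega)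
  · rw [insertKnot_of_le hs le_rfl, insertKnot_self hs]
    exact (hs j).2 le_rfl
  · rw [insertKnot_of_lt hs h]
    obtain ⟨j, rfl⟩ := Nat.exists_eq_add_of_lt h
    rcases Nat.eq_zero_or_pos j with rfl | hj
    · rw [add_zero, insertKnot_self hs]
      exact (not_le.1 (mt (hs _).1 (by omega))).le
    · rw [insertKnot_of_lt hs (by omega)]
      exact hU (by omega)

theorem boehmRatio_eq_one (hs : ∀ j, U j ≤ x ↔ j ≤ s) {q i : ℕ} (h : i + q ≤ s) :
    boehmRatio q U x i = 1 :=
  if_pos ((hs _).2 h)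

theorem boehmRatio_eq_zero (hs : ∀ j, U j ≤ x ↔ j ≤ s) {q i : ℕ} (h : s < i) :
    boehmRatio q U x i = 0 := by
  rw [boehmRatio, if_neg (by rw [hs]; omega),
    if_pos (not_le.1 (mt (hs _).1 (by omega))).le]

theorem boehmRatio_eq_div (hs : ∀ j, U j ≤ x ↔ j ≤ s) {q i : ℕ} (h : i ≤ s) (h' : s < i + q) :
    boehmRatio q U x i = (x - U i) / (U (i + q) - U i) := by
  rw [boehmRatio, if_neg (by rw [hs]; omega)]
  split_ifs with hx
  · have : U i = x := le_antisymm ((hs _).2 h) hx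
    rw [this, sub_self, zero_div]
  · rfl

theorem le_of_forall_iff (hs : ∀ j, U j ≤ x ↔ j ≤ s) {j : ℕ} (h : j ≤ s) : U j ≤ x := (hs j).2 h

theorem lt_of_forall_iff (hs : ∀ j, U j ≤ x ↔ j ≤ s) {j : ℕ} (h : s < j) : x < U j :=
  not_le.1 (mt (hs j).1 (by omega))

/-- Knot insertion for the basis functions: each B-spline is a combination of two consecutive
B-splines on the refined knot vector. -/
theorem bsplineBasis_insertKnot (hU : Monotone U) (hs : ∀ j, U j ≤ x ↔ j ≤ s) (hx : x < 1) (y : ℝ)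
    (q : ℕ) : ∀ i, bsplineBasis U q i y =
      boehmRatio q U x i * bsplineBasis (insertKnot U x) q i y +
        (1 - boehmRatio q U x (i + 1)) * bsplineBasis (insertKnot U x) q (i + 1) y := by
  have hleft : ∀ q i, i + q + 1 ≤ s → bsplineBasis U q i y =
      boehmRatio q U x i * bsplineBasis (insertKnot U x) q i y +
        (1 - boehmRatio q U x (i + 1)) * bsplineBasis (insertKnot U x) q (i + 1) y := by
    intro q i h
    rw [boehmRatio_eq_one hs (by omega), boehmRatio_eq_one hs (by omega), one_mul, sub_self,
      zero_mul, add_zero]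
    exact bsplineBasis_congr y q i i fun j hj => (insertKnot_of_le hs (by omega)).symm
  have hright : ∀ q i, s < i → bsplineBasis U q i y =
      boehmRatio q U x i * bsplineBasis (insertKnot U x) q i y +
        (1 - boehmRatio q U x (i + 1)) * bsplineBasis (insertKnot U x) q (i + 1) y := by
    intro q i h
    rw [boehmRatio_eq_zero hs (by omega), boehmRatio_eq_zero hs (by omega), zero_mul, sub_zero,
      zero_add, one_mul]
    refine bsplineBasis_congr y q i (i + 1) fun j hj => ?_
    rw [add_right_comm]
    exact (insertKnot_of_lt hs (by omega)).symm
  have hzero : ∀ q i, insertKnot U x i = insertKnot U x (i + q + 1) →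
      bsplineBasis (insertKnot U x) q i y = 0 :=
    bsplineBasis_eq_zero_of_eq (monotone_insertKnot hU hs) y
  have hmono := monotone_insertKnot hU hs
  induction q with
  | zero =>
    intro i
    rcases lt_trichotomy i s with h | rfl | h
    · exact hleft 0 i (by omega)
    · rw [boehmRatio_eq_one hs (by omega), boehmRatio_eq_zero hs (by omega)]
      have h1 := le_of_forall_iff hs (le_refl i)
      have h2 := lt_of_forall_iff hs (Nat.lt_succ_self i)
      simp only [bsplineBasis]
      rw [insertKnot_of_le hs le_rfl, insertKnot_self hs, insertKnot_of_lt hs (Nat.lt_succ_self i)]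
      rw [Nat.succ_eq_add_one] at *
      have h3 : x ≠ 1 := hx.ne
      -- The inserted knot splits the interval at `x`. The point `1` is separate because the last
      -- interval is closed; `x < 1` puts it in the right part.
      by_cases hy1 : y = 1
      · subst hy1
        have h4 : ¬ 1 < x := by linarith
        have h5 : U i < 1 := by linarith
        have h6 : x ≤ 1 := by linarith
        simp [h3, h4, h5, h6, hx, h5.le]
      · by_cases hyx : y < x
        · have h4 : ¬ x ≤ y := by linarith
          have h5 : y < U (i + 1) := by linarith
          simp [hy1, hyx, h4, h5]
        · have h4 : x ≤ y := by linarith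
          have h5 : U i ≤ y := by linarith
          simp [hy1, hyx, h4, h5]
    · exact hright 0 i h
  | succ q ih =>
    intro i
    by_cases hl : i + (q + 1) + 1 ≤ s
    · exact hleft _ i hl
    by_cases hr : s < i
    · exact hright _ i hr
    have m1 : U i ≤ U (i + 1) := hU (by omega)
    have m2 : U (i + 1) ≤ U (i + q + 1) := hU (by omega)
    have m3 : U (i + q + 1) ≤ U (i + q + 2) := hU (by omega)
    have hix : U i ≤ x := le_of_forall_iff hs (by omega)
    have hxd : x < U (i + q + 2) := lt_of_forall_iff hs (by omega)
    have e0 : i + (q + 1) = i + q + 1 := rfl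
    have e1 : i + 1 + (q + 1) = i + q + 2 := by omega
    have e2 : i + 1 + q = i + q + 1 := by omega
    have e3 : i + 1 + 1 + q = i + q + 2 := by omega
    -- After the recursion and the induction hypothesis both sides combine three consecutive refined
    -- B-splines of degree `q`. `hfirst`, `hmid` and `hlast` match them one at a time.
    have hfirst : (y - U i) / (U (i + q + 1) - U i) *
        (boehmRatio q U x i * bsplineBasis (insertKnot U x) q i y) =
        boehmRatio (q + 1) U x i * ((y - insertKnot U x i) /
          (insertKnot U x (i + q + 1) - insertKnot U x i) *
            bsplineBasis (insertKnot U x) q i y) := by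
      by_cases hz : insertKnot U x i = insertKnot U x (i + q + 1)
      · rw [hzero q i hz]
        simp
      have hlt := lt_of_le_of_ne (hmono (by omega : i ≤ i + q + 1)) hz
      rw [insertKnot_of_le hs (by omega : i ≤ s)] at hlt ⊢
      rcases lt_trichotomy (i + q) s with h | h | h
      · rw [boehmRatio_eq_one hs (by omega), boehmRatio_eq_one hs (by omega),
          insertKnot_of_le hs (by omega)]
        ring
      · rw [boehmRatio_eq_one hs (by omega), boehmRatio_eq_div hs (by omega) (by omega), h,
          insertKnot_self hs, e0, h]
        rw [h, insertKnot_self hs] at hlt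
        have := (sub_pos.2 hlt).ne'
        have h4 := lt_of_forall_iff hs (Nat.lt_succ_self s)
        rw [Nat.succ_eq_add_one] at h4
        have : U (s + 1) - U i ≠ 0 := by linarith
        field_simp
      · rw [boehmRatio_eq_div hs (by omega) (by omega), boehmRatio_eq_div hs (by omega) (by omega),
          insertKnot_of_lt hs h, e0]
        ring
    have hlast : (U (i + q + 2) - y) / (U (i + q + 2) - U (i + 1)) *
        ((1 - boehmRatio q U x (i + 1 + 1)) * bsplineBasis (insertKnot U x) q (i + 1 + 1) y) =
        (1 - boehmRatio (q + 1) U x (i + 1)) * ((insertKnot U x (i + 1 + q + 2) - y) /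
          (insertKnot U x (i + 1 + q + 2) - insertKnot U x (i + 1 + 1)) *
            bsplineBasis (insertKnot U x) q (i + 1 + 1) y) := by
      have e4 : i + 1 + q + 2 = (i + q + 2) + 1 := by omega
      rw [e4, insertKnot_of_lt hs (by omega : s < i + q + 2)]
      rcases lt_trichotomy (i + 1) s with h | h | h
      · have h2 : U (i + 1 + 1) ≤ x := le_of_forall_iff hs (by omega)
        have m4 : U (i + 1) ≤ U (i + 1 + 1) := hU (by omega)
        rw [boehmRatio_eq_div hs (by omega) (by omega), boehmRatio_eq_div hs (by omega) (by omega),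
          insertKnot_of_le hs (by omega), e1, e3]
        have n1 : U (i + q + 2) - U (i + 1) ≠ 0 := by linarith
        have n2 : U (i + q + 2) - U (i + 1 + 1) ≠ 0 := by linarith
        field_simp
        ring
      · have h2 : U (i + 1) ≤ x := le_of_forall_iff hs (by omega)
        rw [boehmRatio_eq_zero hs (by omega), boehmRatio_eq_div hs (by omega) (by omega), h,
          insertKnot_self hs, e1.symm, h]
        rw [h] at h2
        rw [← e1, h] at hxd
        have n1 : U (s + (q + 1)) - U s ≠ 0 := by linarith
        have n2 : U (s + (q + 1)) - x ≠ 0 := by linarith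
        field_simp
        ring
      · rw [boehmRatio_eq_zero hs (by omega), boehmRatio_eq_zero hs (by omega),
          insertKnot_of_lt hs (by omega)]
        ring
    have hmid : (y - U i) / (U (i + q + 1) - U i) *
        ((1 - boehmRatio q U x (i + 1)) * bsplineBasis (insertKnot U x) q (i + 1) y) +
        (U (i + q + 2) - y) / (U (i + q + 2) - U (i + 1)) *
        (boehmRatio q U x (i + 1) * bsplineBasis (insertKnot U x) q (i + 1) y) =
        boehmRatio (q + 1) U x i * ((insertKnot U x (i + q + 2) - y) /
          (insertKnot U x (i + q + 2) - insertKnot U x (i + 1)) *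
            bsplineBasis (insertKnot U x) q (i + 1) y) +
        (1 - boehmRatio (q + 1) U x (i + 1)) * ((y - insertKnot U x (i + 1)) /
          (insertKnot U x (i + 1 + q + 1) - insertKnot U x (i + 1)) *
            bsplineBasis (insertKnot U x) q (i + 1) y) := by
      have e4 : i + 1 + q + 1 = i + q + 2 := by omega
      by_cases hz : insertKnot U x (i + 1) = insertKnot U x (i + q + 2)
      · rw [hzero q (i + 1) (by rw [e4]; exact hz)]
        simp
      have hlt := lt_of_le_of_ne (hmono (by omega : i + 1 ≤ i + q + 2)) hz
      rw [e4]
      generalize bsplineBasis (insertKnot U x) q (i + 1) y = N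
      by_cases hc : s = i + q + 1
      · have h2 : U (i + q + 1) ≤ x := le_of_forall_iff hs (by omega)
        have e5 : insertKnot U x (i + q + 2) = x := by
          have := insertKnot_self hs
          rwa [hc] at this
        rw [e5, insertKnot_of_le hs (by omega)] at hlt
        rw [boehmRatio_eq_one hs (by omega), boehmRatio_eq_one hs (by omega),
          boehmRatio_eq_div hs (by omega) (by omega), e5, insertKnot_of_le hs (by omega), e1]
        have n1 : U (i + q + 2) - U (i + 1) ≠ 0 := by linarith
        have n2 : x - U (i + 1) ≠ 0 := by linarith
        field_simp
        ring
      · have hxc : x < U (i + q + 1) := lt_of_forall_iff hs (by omega)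
        rw [insertKnot_of_lt hs (by omega : s < i + q + 1)] at hlt ⊢
        rw [boehmRatio_eq_div hs (by omega : i ≤ s) (by omega), e0]
        have n1 : U (i + q + 1) - U i ≠ 0 := by linarith
        by_cases his : i = s
        · have e5 : insertKnot U x (i + 1) = x := by rw [his]; exact insertKnot_self hs
          rw [e5, boehmRatio_eq_zero hs (by omega), boehmRatio_eq_zero hs (by omega)]
          have n3 : U (i + q + 1) - x ≠ 0 := by linarith
          rw [zero_mul, mul_zero, add_zero]
          field_simp
          ring
        · have h2 : U (i + 1) ≤ x := le_of_forall_iff hs (by omega)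
          rw [boehmRatio_eq_div hs (by omega) (by omega), boehmRatio_eq_div hs (by omega) (by omega),
            insertKnot_of_le hs (by omega), e1, e2]
          have n2 : U (i + q + 2) - U (i + 1) ≠ 0 := by linarith
          have n3 : U (i + q + 1) - U (i + 1) ≠ 0 := by linarith
          field_simp
          ring
    simp only [bsplineBasis]
    rw [ih i, ih (i + 1)]
    linear_combination hfirst + hmid + hlast

/-- Boehm's algorithm does not change the spline function. -/
theorem sum_insertCoeff_mul_bsplineBasis (hU : Monotone U) (hs : ∀ j, U j ≤ x ↔ j ≤ s) (hx : x < 1)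
    {p N : ℕ} (hp : p ≤ s) {c : ℕ → ℝ} (hc : ∀ k, N ≤ k → c k = 0) (y : ℝ) :
    ∑ k ∈ Finset.range (N + 1), insertCoeff p U x c k * bsplineBasis (insertKnot U x) p k y =
      ∑ k ∈ Finset.range N, c k * bsplineBasis U p k y := by
  simp only [insertCoeff, add_mul]
  -- Both boundary terms vanish: `c N = 0` at the top, and at index `0` the ratio is `1` because `p
  -- ≤ s`, so the truncated `c (0 - 1)` does not contribute.
  rw [Finset.sum_add_distrib, Finset.sum_range_succ, hc N le_rfl, Finset.sum_range_succ',
    boehmRatio_eq_one hs (i := 0) (by omega)]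
  simp only [mul_zero, zero_mul, add_zero, sub_self, Nat.add_sub_cancel]
  rw [← Finset.sum_add_distrib]
  refine Finset.sum_congr rfl fun k _ => ?_
  rw [bsplineBasis_insertKnot hU hs hx y p k]
  ring

theorem insertCoeff_eq_zero {p N : ℕ} {c : ℕ → ℝ} (hc : ∀ k, N ≤ k → c k = 0) (k : ℕ)
    (hk : N + 1 ≤ k) : insertCoeff p U x c k = 0 := by
  rw [insertCoeff, hc k (by omega), hc (k - 1) (by omega)]
  simp

/-- The support of the coefficients under one step of Boehm's algorithm. -/
theorem insertCoeff_pos_iff (hs : ∀ j, U j ≤ x ↔ j ≤ s) {p r : ℕ}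
    (hr : ∀ j, U j < x ↔ j ≤ r) (hrs : s < r + p) {c : ℕ → ℝ} (hc : ∀ k, 0 ≤ c k) (k : ℕ) :
    0 ≤ insertCoeff p U x c k ∧
      (0 < insertCoeff p U x c k ↔ (k ≤ r ∧ 0 < c k) ∨ (s < k + p ∧ 0 < c (k - 1))) := by
  -- The present multiplicity of `x` is `s - r < p`; so `k + p ≤ s`, where the ratio is `1`, is
  -- compatible with the criterion `k ≤ r` for positivity.
  have h1 : 0 ≤ boehmRatio p U x k ∧ boehmRatio p U x k ≤ 1 ∧
      (0 < boehmRatio p U x k ↔ k ≤ r) ∧ (boehmRatio p U x k < 1 ↔ s < k + p) := by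
    rcases le_or_gt (k + p) s with h | h
    · rw [boehmRatio_eq_one hs h]
      refine ⟨zero_le_one, le_rfl, iff_of_true one_pos (by omega), ?_⟩
      exact iff_of_false (lt_irrefl _) (by omega)
    · rcases le_or_gt k s with h' | h'
      · have h2 := (hs k).2 h'
        have h3 := lt_of_forall_iff hs h
        have h4 : 0 < U (k + p) - U k := by linarith
        rw [boehmRatio_eq_div hs h' h]
        refine ⟨div_nonneg (by linarith) h4.le, ?_, ?_, ?_⟩
        · rw [div_le_one h4]
          linarith
        · rw [div_pos_iff_of_pos_right h4, sub_pos, hr]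
        · rw [div_lt_one h4]
          exact iff_of_true (by linarith) h
      · rw [boehmRatio_eq_zero hs h']
        refine ⟨le_rfl, zero_le_one, iff_of_false (lt_irrefl _) ?_, iff_of_true one_pos h⟩
        intro hk
        exact absurd ((hs k).1 ((hr k).2 hk).le) (by omega)
  obtain ⟨ha, hb, hc1, hc2⟩ := h1
  have hn1 := mul_nonneg ha (hc k)
  have hn2 := mul_nonneg (sub_nonneg.2 hb) (hc (k - 1))
  refine ⟨add_nonneg hn1 hn2, ?_⟩
  rw [← hc1, ← hc2, insertCoeff]
  constructor
  · intro h
    rcases hn1.lt_or_eq with h1 | h1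
    · left
      exact ⟨pos_of_mul_pos_left h1 (hc k), pos_of_mul_pos_right h1 ha⟩
    · right
      have h2 : 0 < (1 - boehmRatio p U x k) * c (k - 1) := by linarith
      exact ⟨sub_pos.1 (pos_of_mul_pos_left h2 (hc _)), pos_of_mul_pos_right h2 (sub_nonneg.2 hb)⟩
  · rintro (⟨h1, h2⟩ | ⟨h1, h2⟩)
    · linarith [mul_pos h1 h2]
    · linarith [mul_pos (sub_pos.2 h1) h2]

end Boehm

/-! ### Raising all interior knots to multiplicity `p` -/

/-- The index of the breakpoint at position `j` of the knot vector in which the interior knots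
before the `r`-th have multiplicity `p`, the `r`-th has multiplicity `μ` and the later ones are
simple. -/
def stageIndex (p n r μ j : ℕ) : ℕ :=
  if j ≤ r * p then (j - 1) / p else if j ≤ r * p + μ then r else min (r + (j - (r * p + μ))) n

/-- The knot vector in which the interior knots before the `r`-th have multiplicity `p`, the `r`-th
has multiplicity `μ` and the later ones are simple. -/
def stageKnots (p n : ℕ) (u : ℕ → ℝ) (r μ j : ℕ) : ℝ := u (stageIndex p n r μ j)

section Stage

variable {p n r μ : ℕ}

theorem stageIndex_lt_iff (hp : 1 ≤ p) (hr : 1 ≤ r) (hrn : r ≤ n) (j : ℕ) :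
    stageIndex p n r μ j < r ↔ j ≤ r * p := by
  have hrp : 1 ≤ r * p := Nat.mul_pos hr hp
  unfold stageIndex
  split_ifs with h1 h2
  · refine iff_of_true ?_ h1
    rw [Nat.div_lt_iff_lt_mul hp]
    omega
  · omega
  · omega

theorem stageIndex_le_iff (hp : 1 ≤ p) (hr : 1 ≤ r) (hrn : r < n) (j : ℕ) :
    stageIndex p n r μ j ≤ r ↔ j ≤ r * p + μ := by
  have h := stageIndex_lt_iff (μ := μ) hp hr hrn.le j
  by_cases h1 : j ≤ r * p
  · exact iff_of_true (h.2 h1).le (by omega)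
  · unfold stageIndex
    rw [if_neg h1]
    split_ifs <;> omega

theorem stageIndex_le (hp : 1 ≤ p) (hr : 1 ≤ r) (hrn : r ≤ n) (j : ℕ) :
    stageIndex p n r μ j ≤ n := by
  have h := stageIndex_lt_iff (μ := μ) hp hr hrn j
  by_cases h1 : j ≤ r * p
  · exact (h.2 h1).le.trans hrn
  · unfold stageIndex
    rw [if_neg h1]
    split_ifs <;> omega

theorem monotone_stageIndex (hp : 1 ≤ p) (hr : 1 ≤ r) (hrn : r ≤ n) :
    Monotone (stageIndex p n r μ) := by
  intro i j hij
  by_cases h1 : j ≤ r * p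
  · unfold stageIndex
    rw [if_pos h1, if_pos (by omega)]
    exact Nat.div_le_div_right (by omega)
  · by_cases h2 : i ≤ r * p
    · have h3 := (stageIndex_lt_iff (μ := μ) hp hr hrn i).2 h2
      have h4 := mt (stageIndex_lt_iff (μ := μ) hp hr hrn j).1 h1
      omega
    · unfold stageIndex
      rw [if_neg h1, if_neg h2]
      split_ifs <;> omega

variable {u : ℕ → ℝ}

theorem strictMonoOn_of_lt_succ (hu : ∀ i < n, u i < u (i + 1)) : StrictMonoOn u (Set.Iic n) := by
  intro i _ j hj hij
  rw [Set.mem_Iic] at hj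
  obtain ⟨k, rfl⟩ := Nat.exists_eq_add_of_lt hij
  clear hij
  induction k with
  | zero => exact hu i (by omega)
  | succ k ih => exact (ih (by omega)).trans (hu (i + k + 1) (by omega))

theorem monotone_stageKnots (hu : StrictMonoOn u (Set.Iic n)) (hp : 1 ≤ p) (hr : 1 ≤ r)
    (hrn : r ≤ n) : Monotone (stageKnots p n u r μ) := fun i j hij =>
  hu.monotoneOn (stageIndex_le hp hr hrn i) (stageIndex_le hp hr hrn j)
    (monotone_stageIndex hp hr hrn hij)

theorem stageKnots_le_iff (hu : StrictMonoOn u (Set.Iic n)) (hp : 1 ≤ p) (hr : 1 ≤ r)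
    (hrn : r < n) (j : ℕ) : stageKnots p n u r μ j ≤ u r ↔ j ≤ r * p + μ := by
  rw [← stageIndex_le_iff hp hr hrn]
  exact hu.le_iff_le (stageIndex_le hp hr hrn.le j) hrn.le

theorem stageKnots_lt_iff (hu : StrictMonoOn u (Set.Iic n)) (hp : 1 ≤ p) (hr : 1 ≤ r)
    (hrn : r < n) (j : ℕ) : stageKnots p n u r μ j < u r ↔ j ≤ r * p := by
  rw [← stageIndex_lt_iff (μ := μ) hp hr hrn.le]
  exact hu.lt_iff_lt (stageIndex_le hp hr hrn.le j) hrn.le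

theorem insertKnot_stageKnots (hu : StrictMonoOn u (Set.Iic n)) (hp : 1 ≤ p) (hr : 1 ≤ r)
    (hrn : r < n) :
    insertKnot (stageKnots p n u r μ) (u r) = stageKnots p n u r (μ + 1) := by
  have hs := stageKnots_le_iff (μ := μ) hu hp hr hrn
  funext j
  rcases le_or_gt j (r * p + μ) with h | h
  · rw [insertKnot_of_le hs h, stageKnots, stageKnots]
    congr 1
    unfold stageIndex
    split_ifs <;> omega
  · obtain ⟨k, rfl⟩ := Nat.exists_eq_add_of_lt h
    rcases Nat.eq_zero_or_pos k with rfl | hk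
    · rw [add_zero, insertKnot_self hs, stageKnots]
      congr 1
      unfold stageIndex
      split_ifs <;> omega
    · rw [insertKnot_of_lt hs (by omega), stageKnots, stageKnots]
      congr 1
      unfold stageIndex
      split_ifs <;> omega

/-- The positions `r p + 1, …, r p + p` are those with `(j - 1) / p = r`, so a knot of multiplicity
`p` joins the finished block. -/
theorem stageKnots_succ (hp : 1 ≤ p) (hrn : r < n) :
    stageKnots p n u r p = stageKnots p n u (r + 1) 1 := by
  funext j
  rw [stageKnots, stageKnots]
  congr 1
  have e : (r + 1) * p = r * p + p := by ring
  unfold stageIndex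
  rw [e]
  by_cases h1 : j ≤ r * p
  · rw [if_pos h1, if_pos (by omega)]
  · rw [if_neg h1]
    by_cases h2 : j ≤ r * p + p
    · rw [if_pos h2, if_pos h2]
      obtain ⟨k, rfl⟩ := Nat.exists_eq_add_of_lt (not_le.1 h1)
      rw [Nat.add_sub_cancel, Nat.mul_comm, Nat.mul_add_div hp, Nat.div_eq_of_lt (by omega)]
      rfl
    · rw [if_neg h2, if_neg h2]
      split_ifs <;> omega

theorem stageKnots_one_one (hp : 1 ≤ p) (hn : 1 ≤ n) :
    stageKnots p n u 1 1 = knotVector p n u := by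
  funext j
  rw [stageKnots, knotVector]
  congr 1
  unfold stageIndex
  rw [one_mul]
  by_cases h1 : j ≤ p
  · rw [if_pos h1, Nat.div_eq_of_lt (by omega)]
    omega
  · rw [if_neg h1]
    split_ifs <;> omega

theorem stageKnots_last (hp : 1 ≤ p) (j : ℕ) :
    stageKnots p n u n 1 j = u (min ((j - 1) / p) n) := by
  rw [stageKnots]
  congr 1
  unfold stageIndex
  by_cases h1 : j ≤ n * p
  · rw [if_pos h1, min_eq_left]
    rcases Nat.eq_zero_or_pos n with rfl | hn
    · rw [zero_mul] at h1
      rw [Nat.div_eq_of_lt (by omega)]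
    · have := Nat.mul_pos hn hp
      exact ((Nat.div_lt_iff_lt_mul hp).2 (by omega)).le
  · rw [if_neg h1]
    have : n ≤ (j - 1) / p := (Nat.le_div_iff_mul_le hp).2 (by omega)
    split_ifs <;> omega

/-- Induction along the insertion of the knots. -/
theorem insertCoeffs_induction (hu : StrictMonoOn u (Set.Iic n)) (hp : 1 ≤ p) (hn : 1 ≤ n)
    {Φ : ℕ → ℕ → (ℕ → ℝ) → Prop} {c₀ : ℕ → ℝ} (h₀ : Φ 1 1 c₀)
    (hstep : ∀ r μ c, 1 ≤ r → r < n → 1 ≤ μ → μ < p → Φ r μ c →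
      Φ r (μ + 1) (insertCoeff p (stageKnots p n u r μ) (u r) c))
    (hnext : ∀ r c, 1 ≤ r → r < n → Φ r p c → Φ (r + 1) 1 c) :
    Φ n 1 (insertCoeffs p (knotVector p n u) (insertedKnots p n u) c₀) := by
  -- The remaining `ν` insertions of `u r`, in front of an arbitrary tail `L`; `houter` runs this
  -- over the successive knots.
  have hinner : ∀ ν r μ c (L : List ℝ), 1 ≤ r → r < n → 1 ≤ μ → μ + ν = p → Φ r μ c →
      ∃ c', Φ r p c' ∧ insertCoeffs p (stageKnots p n u r μ) (List.replicate ν (u r) ++ L) c =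
        insertCoeffs p (stageKnots p n u r p) L c' := by
    intro ν
    induction ν with
    | zero =>
      rintro r μ c L h1 h2 h3 rfl hΦ
      exact ⟨c, hΦ, rfl⟩
    | succ ν ih =>
      intro r μ c L h1 h2 h3 h4 hΦ
      obtain ⟨c', h5, h6⟩ := ih r (μ + 1) _ L h1 h2 (by omega) (by omega)
        (hstep r μ c h1 h2 h3 (by omega) hΦ)
      refine ⟨c', h5, ?_⟩
      rw [List.replicate_succ, List.cons_append, insertCoeffs, insertKnot_stageKnots hu hp h1 h2, h6]
  have houter : ∀ ν r c, 1 ≤ r → r + ν = n → Φ r 1 c →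
      Φ n 1 (insertCoeffs p (stageKnots p n u r 1)
        ((List.range' r ν).flatMap fun i => List.replicate (p - 1) (u i)) c) := by
    intro ν
    induction ν with
    | zero =>
      rintro r c h1 rfl hΦ
      exact hΦ
    | succ ν ih =>
      intro r c h1 h2 hΦ
      rw [List.range'_succ, List.flatMap_cons]
      obtain ⟨c', h3, h4⟩ := hinner (p - 1) r 1 c _ h1 (by omega) le_rfl (by omega) hΦ
      rw [h4, stageKnots_succ hp (by omega)]
      exact ih (r + 1) c' (by omega) (by omega) (hnext r c' h1 (by omega) h3)
  have h := houter (n - 1) 1 c₀ le_rfl (by omega) h₀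
  rw [stageKnots_one_one hp hn] at h
  have e : insertedKnots p n u =
      (List.range' 1 (n - 1)).flatMap fun i => List.replicate (p - 1) (u i) := by
    rw [List.range'_eq_map_range, List.flatMap_map, insertedKnots]
    simp only [add_comm 1]
  rwa [e]

/-! ### Supports of the insertion coefficients -/

/-- The first index in the support of the `i`-th column of coefficients. -/
def supportMin (p i r μ : ℕ) : ℕ :=
  i + min (i - p) (r - 1) * (p - 1) + if r ≤ i - p then μ - 1 else 0

/-- The last index in the support of the `i`-th column of coefficients. -/
def supportMax (p i r μ : ℕ) : ℕ :=
  i + min i (r - 1) * (p - 1) + if r ≤ i then μ - 1 else 0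

/-- The basis function with index `i` lives between the breakpoints `i - p` and `i + 1`, cut off at
the ends. Inserted knots `u q` with `q ≤ i - p` shift the lower end of the support, those with `q ≤
i` the upper end. In `insertCoeff_pos_iff` an entry keeps its own coefficient as long as its index
is at most `r p`. -/
theorem supportMin_step (hp : 1 ≤ p) (hr : 1 ≤ r) (hμ : 1 ≤ μ) (i : ℕ) :
    supportMin p i r (μ + 1) =
      if r * p < supportMin p i r μ then supportMin p i r μ + 1 else supportMin p i r μ := by
  obtain ⟨r, rfl⟩ := Nat.exists_eq_add_of_le' hr
  obtain ⟨p, rfl⟩ := Nat.exists_eq_add_of_le' hp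
  unfold supportMin
  simp only [Nat.add_sub_cancel]
  by_cases h : r + 1 ≤ i - (p + 1)
  · have e1 : min (i - (p + 1)) r = r := by omega
    have e2 : (r + 1) * (p + 1) = r * p + r + p + 1 := by ring
    rw [if_pos h, if_pos h, e1, e2, if_pos (by omega)]
    omega
  · have e1 : min (i - (p + 1)) r = i - (p + 1) := by omega
    rw [if_neg h, if_neg h, e1, if_neg]
    rcases Nat.le_total i (p + 1) with h1 | h1
    · have e2 : i - (p + 1) = 0 := by omega
      rw [e2]
      nlinarith
    · obtain ⟨q, rfl⟩ := Nat.exists_eq_add_of_le h1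
      rw [Nat.add_sub_cancel_left] at *
      have : q ≤ r := by omega
      nlinarith

/-- The entry just above the support inherits from its predecessor under the second alternative of
`insertCoeff_pos_iff`, evaluated at the maximum plus one. -/
theorem supportMax_step (hp : 1 ≤ p) (hr : 1 ≤ r) (hμ : 1 ≤ μ) (i : ℕ) :
    supportMax p i r (μ + 1) = if r * p + μ ≤ supportMax p i r μ + p then supportMax p i r μ + 1
      else supportMax p i r μ := by
  obtain ⟨r, rfl⟩ := Nat.exists_eq_add_of_le' hr
  obtain ⟨p, rfl⟩ := Nat.exists_eq_add_of_le' hp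
  unfold supportMax
  simp only [Nat.add_sub_cancel]
  have e2 : (r + 1) * (p + 1) = r * p + r + p + 1 := by ring
  by_cases h : r + 1 ≤ i
  · have e1 : min i r = r := by omega
    rw [if_pos h, if_pos h, e1, e2, if_pos (by omega)]
    omega
  · have e1 : min i r = i := by omega
    rw [if_neg h, if_neg h, e1, if_neg]
    have : i ≤ r := by omega
    nlinarith

theorem supportMin_next (hr : 1 ≤ r) (i : ℕ) : supportMin p i (r + 1) 1 = supportMin p i r p := by
  obtain ⟨r, rfl⟩ := Nat.exists_eq_add_of_le' hr
  unfold supportMin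
  simp only [Nat.add_sub_cancel, Nat.sub_self, ite_self, add_zero]
  split_ifs with h
  · have e1 : min (i - p) (r + 1) = r + 1 := by omega
    have e2 : min (i - p) r = r := by omega
    rw [e1, e2]
    ring
  · have e1 : min (i - p) (r + 1) = min (i - p) r := by omega
    rw [e1, add_zero]

theorem supportMax_next (hr : 1 ≤ r) (i : ℕ) : supportMax p i (r + 1) 1 = supportMax p i r p := by
  obtain ⟨r, rfl⟩ := Nat.exists_eq_add_of_le' hr
  unfold supportMax
  simp only [Nat.add_sub_cancel, Nat.sub_self, ite_self, add_zero]
  split_ifs with h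
  · have e1 : min i (r + 1) = r + 1 := by omega
    have e2 : min i r = r := by omega
    rw [e1, e2]
    ring
  · have e1 : min i (r + 1) = min i r := by omega
    rw [e1, add_zero]

theorem supportMin_le_supportMax (i : ℕ) : supportMin p i r μ ≤ supportMax p i r μ := by
  unfold supportMin supportMax
  have h1 : min (i - p) (r - 1) * (p - 1) ≤ min i (r - 1) * (p - 1) :=
    Nat.mul_le_mul_right _ (by omega)
  split_ifs <;> omega

/-- Each insertion preserves nonnegativity and turns an interval of positive entries into an
interval: for `μ < p` the two index ranges of `insertCoeff_pos_iff` overlap, so no gap opens. -/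
theorem insertionCoeff_support (hu : StrictMonoOn u (Set.Iic n)) (hp : 1 ≤ p) (hn : 1 ≤ n)
    (i k : ℕ) : 0 ≤ insertionCoeff p n u k i ∧ (0 < insertionCoeff p n u k i ↔
      supportMin p i n 1 ≤ k ∧ k ≤ supportMax p i n 1) := by
  refine insertCoeffs_induction hu hp hn (c₀ := Pi.single i 1) (Φ := fun r μ c =>
    ∀ k, 0 ≤ c k ∧ (0 < c k ↔ supportMin p i r μ ≤ k ∧ k ≤ supportMax p i r μ)) ?_ ?_ ?_ k
  · intro k
    have e1 : supportMin p i 1 1 = i := by simp [supportMin]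
    have e2 : supportMax p i 1 1 = i := by simp [supportMax]
    rw [e1, e2]
    by_cases h : k = i
    · subst h
      simp
    · rw [Pi.single_eq_of_ne h]
      simp only [le_refl, lt_irrefl, false_iff, true_and]
      omega
  · intro r μ c hr hrn hμ hμp hc k
    have hs := stageKnots_le_iff (μ := μ) hu hp hr hrn
    obtain ⟨h1, h2⟩ := insertCoeff_pos_iff hs (stageKnots_lt_iff hu hp hr hrn)
      (by omega : r * p + μ < r * p + p) (fun k => (hc k).1) k
    refine ⟨h1, ?_⟩
    rw [h2, (hc k).2, (hc (k - 1)).2, supportMin_step hp hr hμ, supportMax_step hp hr hμ]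
    have h3 := supportMin_le_supportMax (p := p) (r := r) (μ := μ) i
    have h4 : p ≤ r * p := Nat.le_mul_of_pos_left p hr
    split_ifs <;> omega
  · intro r c hr hrn hc
    rw [supportMin_next hr, supportMax_next hr]
    exact hc

/-- Column `i` is what Boehm's algorithm makes of the unit sequence at `i`. Every insertion keeps
the spline and adds one coefficient, ending with `n p + 1` of them. -/
theorem bsplineBasis_eq_sum_insertionCoeff (hu : StrictMonoOn u (Set.Iic n)) (hun : u n = 1)
    (hp : 1 ≤ p) (hn : 1 ≤ n) {i : ℕ} (hi : i < n + p) (y : ℝ) :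
    bsplineBasis (knotVector p n u) p i y = ∑ k ∈ Finset.range (n * p + 1),
      insertionCoeff p n u k i * bsplineBasis (stageKnots p n u n 1) p k y := by
  have h := insertCoeffs_induction hu hp hn (c₀ := Pi.single i 1) (Φ := fun r μ c =>
    (∀ k, n + p + (r - 1) * (p - 1) + (μ - 1) ≤ k → c k = 0) ∧
    ∑ k ∈ Finset.range (n + p + (r - 1) * (p - 1) + (μ - 1)),
      c k * bsplineBasis (stageKnots p n u r μ) p k y =
        bsplineBasis (knotVector p n u) p i y) ?_ ?_ ?_
  · have e : n + p + (n - 1) * (p - 1) + (1 - 1) = n * p + 1 := by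
      obtain ⟨n, rfl⟩ := Nat.exists_eq_add_of_le' hn
      obtain ⟨p, rfl⟩ := Nat.exists_eq_add_of_le' hp
      simp only [Nat.add_sub_cancel, Nat.sub_self]
      ring
    rw [e] at h
    exact h.2.symm
  · constructor
    · intro k hk
      exact Pi.single_eq_of_ne (by omega) _
    · rw [stageKnots_one_one hp hn, Finset.sum_eq_single i]
      · simp
      · intro k _ hk
        rw [Pi.single_eq_of_ne hk, zero_mul]
      · intro h
        simp only [Finset.mem_range] at h
        omega
  · rintro r μ c hr hrn hμ hμp ⟨h1, h2⟩
    have e : n + p + (r - 1) * (p - 1) + (μ + 1 - 1) =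
        n + p + (r - 1) * (p - 1) + (μ - 1) + 1 := by omega
    rw [e]
    have h4 : p ≤ r * p := Nat.le_mul_of_pos_left p hr
    refine ⟨fun k hk => insertCoeff_eq_zero h1 k hk, ?_⟩
    rw [← insertKnot_stageKnots hu hp hr hrn, ← h2]
    exact sum_insertCoeff_mul_bsplineBasis (monotone_stageKnots hu hp hr hrn.le)
      (stageKnots_le_iff hu hp hr hrn) (hun ▸ hu hrn.le (Set.mem_Iic.2 le_rfl) hrn)
      (by omega) h1 y
  · rintro r c hr hrn ⟨h1, h2⟩
    have e : n + p + (r + 1 - 1) * (p - 1) + (1 - 1) = n + p + (r - 1) * (p - 1) + (p - 1) := by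
      obtain ⟨r, rfl⟩ := Nat.exists_eq_add_of_le' hr
      simp only [Nat.add_sub_cancel]
      ring
    rw [e, ← stageKnots_succ hp hrn]
    exact ⟨h1, h2⟩

theorem mem_window_iff (hp : 1 ≤ p) {m j i : ℕ} (hm : m < n) (hj : j ≤ p) :
    i ∈ window p n m j ↔ i < n + p ∧
      supportMin p i n 1 ≤ m * p + j ∧ m * p + j ≤ supportMax p i n 1 := by
  obtain ⟨n, rfl⟩ := Nat.exists_eq_add_of_le' (show 1 ≤ n by omega)
  by_cases hi : i < n + 1 + p
  swap
  · refine iff_of_false ?_ fun h => hi h.1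
    unfold window
    split_ifs <;> simp <;> omega
  -- For `i > p` the lower end is the multiple `(i - p + 1) p`; this is why `j = p` admits one more
  -- index than interior `j`.
  have hmin : supportMin p i (n + 1) 1 ≤ m * p + j ↔
      if m = 0 then i ≤ j else if j = p then i ≤ m + p else i + 1 ≤ m + p := by
    unfold supportMin
    simp only [Nat.add_sub_cancel, Nat.sub_self, ite_self, add_zero]
    rcases Nat.lt_or_ge p i with h | h
    · obtain ⟨q, rfl⟩ := Nat.exists_eq_add_of_lt h
      have e1 : min (p + q + 1 - p) n = q + 1 := by omega
      have e2 : p + q + 1 + (q + 1) * (p - 1) = (q + 2) * p := by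
        obtain ⟨p, rfl⟩ := Nat.exists_eq_add_of_le' hp
        simp only [Nat.add_sub_cancel]
        ring
      rw [e1, e2]
      split_ifs with h1 h2
      · subst h1
        refine iff_of_false ?_ (by omega)
        nlinarith
      · subst h2
        have : m * j + j = (m + 1) * j := by ring
        rw [this, Nat.mul_le_mul_right_iff hp]
        omega
      · have hlt : j < p := by omega
        constructor
        · intro h3
          have : (q + 2) * p < (m + 1) * p := by nlinarith
          have := Nat.lt_of_mul_lt_mul_right this
          omega
        · intro h3
          have : (q + 2) * p ≤ m * p := Nat.mul_le_mul_right p (by omega)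
          omega
    · have e1 : i - p = 0 := by omega
      rw [e1]
      simp only [Nat.zero_min, zero_mul, add_zero]
      split_ifs with h1 h2
      · subst h1
        simp
      · have : p ≤ m * p := Nat.le_mul_of_pos_left p (by omega)
        omega
      · have : p ≤ m * p := Nat.le_mul_of_pos_left p (by omega)
        omega
  -- With `n + 1` pieces the upper end is `i p` for `i < n`, and `n p + (i - n)` afterwards, which
  -- gives the separate rule on the last piece.
  have hmax : m * p + j ≤ supportMax p i (n + 1) 1 ↔
      if m = n then n + j ≤ i else if j = 0 then m ≤ i else m + 1 ≤ i := by
    unfold supportMax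
    simp only [Nat.add_sub_cancel, Nat.sub_self, ite_self, add_zero]
    rcases Nat.lt_or_ge i n with h | h
    · have e1 : min i n = i := by omega
      have e2 : i + i * (p - 1) = i * p := by
        obtain ⟨p, rfl⟩ := Nat.exists_eq_add_of_le' hp
        simp only [Nat.add_sub_cancel]
        ring
      rw [e1, e2]
      split_ifs with h1 h2
      · subst h1
        refine iff_of_false ?_ (by omega)
        have : (i + 1) * p ≤ m * p := Nat.mul_le_mul_right p h
        nlinarith
      · subst h2
        rw [add_zero, Nat.mul_le_mul_right_iff hp]
      · constructor
        · intro h3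
          have : m * p < i * p := by omega
          have := Nat.lt_of_mul_lt_mul_right this
          omega
        · intro h3
          have : (m + 1) * p ≤ i * p := Nat.mul_le_mul_right p h3
          nlinarith
    · obtain ⟨q, rfl⟩ := Nat.exists_eq_add_of_le h
      have e1 : min (n + q) n = n := by omega
      have e2 : n + q + n * (p - 1) = n * p + q := by
        obtain ⟨p, rfl⟩ := Nat.exists_eq_add_of_le' hp
        simp only [Nat.add_sub_cancel]
        ring
      rw [e1, e2]
      split_ifs with h1 h2
      · subst h1
        omega
      · have : (m + 1) * p ≤ n * p := Nat.mul_le_mul_right p (by omega)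
        have : (m + 1) * p = m * p + p := by ring
        omega
      · have : (m + 1) * p ≤ n * p := Nat.mul_le_mul_right p (by omega)
        have : (m + 1) * p = m * p + p := by ring
        omega
  rw [hmin, hmax]
  unfold window
  split_ifs <;> simp only [Finset.mem_singleton, Finset.mem_Icc] <;> omega

theorem window_nonempty (hp : 1 ≤ p) {m j : ℕ} (hm : m < n) (hj : j ≤ p) :
    (window p n m j).Nonempty := by
  unfold window
  split_ifs <;> simp <;> omega

end Stage

/-! ### The Bézier pieces -/

/-- Between two consecutive knots of multiplicity `p`, the B-splines are Bernstein polynomials. -/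
theorem bsplineBasis_eq_bernstein {V : ℕ → ℝ} {p s : ℕ} {a b y : ℝ}
    (hbase : ∀ k, bsplineBasis V 0 k y = if k = s then 1 else 0)
    (ha : ∀ j, s < j + p → j ≤ s → V j = a) (hb : ∀ j, s < j → j ≤ s + p → V j = b) (q : ℕ)
    (hq : q ≤ p) : ∀ k, bsplineBasis V q k y = if s ≤ k + q ∧ k ≤ s then
      (q.choose (k + q - s) : ℝ) * ((y - a) / (b - a)) ^ (k + q - s) *
        ((b - y) / (b - a)) ^ (s - k) else 0 := by
  induction q with
  | zero =>
    intro k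
    rw [hbase]
    by_cases h : k = s
    · subst h
      simp
    · rw [if_neg h, if_neg (by omega)]
  | succ q ih =>
    intro k
    have ih := ih (by omega)
    simp only [bsplineBasis]
    rw [ih k, ih (k + 1)]
    by_cases h1 : s ≤ k + (q + 1) ∧ k ≤ s
    swap
    · rw [if_neg h1, if_neg (by omega), if_neg (by omega)]
      simp
    rw [if_pos h1]
    rcases Nat.eq_or_lt_of_le h1.1 with h2 | h2
    · rw [if_neg (by omega), if_pos (by omega), ha (k + 1) (by omega) (by omega),
        hb (k + q + 2) (by omega) (by omega)]
      have e1 : k + 1 + q - s = 0 := by omega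
      have e2 : k + (q + 1) - s = 0 := by omega
      have e3 : s - k = (s - (k + 1)) + 1 := by omega
      rw [e1, e2, e3, pow_succ]
      simp only [Nat.choose_zero_right]
      ring
    · rw [if_pos (by omega), ha k (by omega) (by omega), hb (k + q + 1) (by omega) (by omega)]
      rcases Nat.eq_or_lt_of_le h1.2 with h3 | h3
      · rw [if_neg (by omega)]
        have e1 : k + q - s = q := by omega
        have e2 : k + (q + 1) - s = q + 1 := by omega
        rw [e1, e2, Nat.choose_self, Nat.choose_self, pow_succ]
        ring
      · rw [if_pos (by omega), ha (k + 1) (by omega) (by omega),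
          hb (k + q + 2) (by omega) (by omega)]
        have e1 : k + (q + 1) - s = (k + q - s) + 1 := by omega
        have e2 : k + 1 + q - s = (k + q - s) + 1 := by omega
        have e3 : s - k = (s - (k + 1)) + 1 := by omega
        -- Away from the two extreme indices both terms of the recursion survive and add up by
        -- Pascal's rule.
        rw [e1, e2, e3, Nat.choose_succ_succ]
        push_cast
        ring

section Piece

variable {p n : ℕ} {u : ℕ → ℝ}

theorem bsplineBasis_zero_stageKnots (hu : StrictMonoOn u (Set.Iic n)) (hun : u n = 1)
    (hp : 1 ≤ p) {m : ℕ} (hm : m < n) {y : ℝ} (hy : u m ≤ y)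
    (hy' : y < u (m + 1) ∨ (y = 1 ∧ m + 1 = n)) (k : ℕ) :
    bsplineBasis (stageKnots p n u n 1) 0 k y = if k = (m + 1) * p then 1 else 0 := by
  have hn : 1 ≤ n := by omega
  have hmono : Monotone (stageKnots p n u n 1) := monotone_stageKnots hu hp hn le_rfl
  have hs : stageKnots p n u n 1 ((m + 1) * p) = u m := by
    rw [stageKnots_last hp]
    congr 1
    have : ((m + 1) * p - 1) / p = m := by
      have e : (m + 1) * p - 1 = p * m + (p - 1) := by
        rw [add_mul, one_mul, mul_comm, Nat.add_sub_assoc hp]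
      rw [e, Nat.mul_add_div hp, Nat.div_eq_of_lt (by omega), add_zero]
    omega
  have hs' : stageKnots p n u n 1 ((m + 1) * p + 1) = u (m + 1) := by
    rw [stageKnots_last hp, Nat.add_sub_cancel, Nat.mul_div_cancel _ hp]
    congr 1
    omega
  have hum : u m < u (m + 1) := hu (Set.mem_Iic.2 hm.le) (Set.mem_Iic.2 hm) (Nat.lt_succ_self m)
  have hle : ∀ j ≤ n, u j ≤ 1 := fun j hj =>
    hun ▸ hu.monotoneOn (Set.mem_Iic.2 hj) (Set.mem_Iic.2 le_rfl) hj
  have hum1 := hle (m + 1) hm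
  simp only [bsplineBasis]
  by_cases hk : k = (m + 1) * p
  · rw [if_pos hk, if_pos]
    rw [hk, hs, hs']
    rcases hy' with h | ⟨h1, h2⟩
    · exact Or.inl ⟨hy, h⟩
    · rw [h2, hun] at hum ⊢
      exact Or.inr ⟨h1, hum, rfl⟩
  · rw [if_neg hk, if_neg]
    rcases Nat.lt_or_gt_of_ne hk with h | h
    · have h1 : stageKnots p n u n 1 (k + 1) ≤ u m := hs ▸ hmono h
      rintro (⟨h2, h3⟩ | ⟨h2, h3, h4⟩) <;> linarith
    · have h1 : u (m + 1) ≤ stageKnots p n u n 1 k := hs' ▸ hmono h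
      have h5 : stageKnots p n u n 1 (k + 1) ≤ 1 := hle _ (stageIndex_le hp hn le_rfl _)
      rcases hy' with h' | ⟨h1', h2'⟩
      · rintro (⟨h2, h3⟩ | ⟨h2, h3, h4⟩) <;> linarith
      · rw [h2', hun] at h1
        rintro (⟨h2, h3⟩ | ⟨h2, h3, h4⟩) <;> linarith

theorem pieceLattice_nontrivial (hp : 1 ≤ p) (m : ℕ) : (pieceLattice p m).Nontrivial := by
  have e : (m + 1) * p = m * p + p := by ring
  refine ⟨m * p, ?_, (m + 1) * p, ?_, by omega⟩ <;>
    simp only [pieceLattice, Finset.coe_Icc, Set.mem_Icc] <;> omega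

theorem sInf_pieceLattice (p m : ℕ) : sInf (pieceLattice p m : Set ℕ) = m * p := by
  rw [pieceLattice, Finset.coe_Icc, csInf_Icc (Nat.mul_le_mul_right p (Nat.le_succ m))]

theorem sSup_pieceLattice (p m : ℕ) : sSup (pieceLattice p m : Set ℕ) = (m + 1) * p := by
  rw [pieceLattice, Finset.coe_Icc, csSup_Icc (Nat.mul_le_mul_right p (Nat.le_succ m))]

/-- The toric basis functions of a piece are the Bernstein polynomials. -/
theorem toricBasis_pieceLattice (hp : 1 ≤ p) {m k : ℕ} (hk : k ∈ pieceLattice p m) (z : ℝ) :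
    toricBasis (pieceLattice p m) (pieceBasisCoeff p m) k (m * p + p * z) =
      (p.choose (k - m * p) : ℝ) * z ^ (k - m * p) * (1 - z) ^ ((m + 1) * p - k) := by
  rw [pieceLattice, Finset.mem_Icc] at hk
  rw [toricBasis, sInf_pieceLattice, sSup_pieceLattice, pieceBasisCoeff]
  have e : (m + 1) * p = m * p + p := by ring
  have e1 : (m * p + p * z : ℝ) - ((m * p : ℕ) : ℝ) = p * z := by push_cast; ring
  have e2 : (((m + 1) * p : ℕ) : ℝ) - (m * p + p * z) = p * (1 - z) := by push_cast; ring
  have e3 : (p : ℝ) ^ p = p ^ (k - m * p) * p ^ ((m + 1) * p - k) := by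
    rw [← pow_add]
    congr 1
    omega
  have hp0 : (p : ℝ) ≠ 0 := by exact_mod_cast (by omega : p ≠ 0)
  rw [e1, e2, mul_pow, mul_pow, e3]
  field_simp

/-- The B-splines on a piece in terms of the Bernstein basis. -/
theorem bsplineBasis_eq_sum_toricBasis (hu : StrictMonoOn u (Set.Iic n)) (hun : u n = 1)
    (hp : 1 ≤ p) {m : ℕ} (hm : m < n) {y : ℝ} (hy : u m ≤ y)
    (hy' : y < u (m + 1) ∨ (y = 1 ∧ m + 1 = n)) {i : ℕ} (hi : i < n + p) :
    bsplineBasis (knotVector p n u) p i y = ∑ k ∈ pieceLattice p m, insertionCoeff p n u k i *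
      toricBasis (pieceLattice p m) (pieceBasisCoeff p m) k
        (m * p + p * ((y - u m) / (u (m + 1) - u m))) := by
  have hn : 1 ≤ n := by omega
  have hum : u m < u (m + 1) := hu (Set.mem_Iic.2 hm.le) (Set.mem_Iic.2 hm) (Nat.lt_succ_self m)
  have e : (m + 1) * p = m * p + p := by ring
  have hmn : (m + 1) * p ≤ n * p := Nat.mul_le_mul_right p hm
  have hB := bsplineBasis_eq_bernstein (p := p) (V := stageKnots p n u n 1)
    (a := u m) (b := u (m + 1))
    (bsplineBasis_zero_stageKnots hu hun hp hm hy hy') (by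
      intro j h1 h2
      rw [stageKnots_last hp]
      congr 1
      obtain ⟨q, rfl⟩ := Nat.exists_eq_add_of_lt (show m * p < j by omega)
      have : (m * p + q + 1 - 1) / p = m := by
        rw [Nat.add_sub_cancel, mul_comm, Nat.mul_add_div hp, Nat.div_eq_of_lt (by omega), add_zero]
      omega) (by
      intro j h1 h2
      rw [stageKnots_last hp]
      congr 1
      obtain ⟨q, rfl⟩ := Nat.exists_eq_add_of_lt h1
      have : ((m + 1) * p + q + 1 - 1) / p = m + 1 := by
        rw [Nat.add_sub_cancel, mul_comm, Nat.mul_add_div hp, Nat.div_eq_of_lt (by omega), add_zero]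
      omega) p le_rfl
  rw [bsplineBasis_eq_sum_insertionCoeff hu hun hp hn hi]
  symm
  refine Finset.sum_subset_zero_on_sdiff ?_ ?_ ?_
  · intro k hk
    rw [pieceLattice, Finset.mem_Icc] at hk
    rw [Finset.mem_range]
    omega
  · intro k hk
    rw [Finset.mem_sdiff, pieceLattice, Finset.mem_Icc] at hk
    rw [hB, if_neg (by omega), mul_zero]
  · intro k hk
    rw [toricBasis_pieceLattice hp hk]
    rw [pieceLattice, Finset.mem_Icc] at hk
    have e1 : k + p - (m + 1) * p = k - m * p := by omega
    have e2 : 1 - (y - u m) / (u (m + 1) - u m) = (u (m + 1) - y) / (u (m + 1) - u m) := by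
      have : u (m + 1) - u m ≠ 0 := (sub_pos.2 hum).ne'
      field_simp
      ring
    rw [hB, if_pos (by omega), e1, e2]

theorem insertionCoeff_pos_iff_mem_window (hu : StrictMonoOn u (Set.Iic n)) (hp : 1 ≤ p)
    {m k i : ℕ} (hm : m < n) (hk : k ∈ pieceLattice p m) (hi : i < n + p) :
    0 < insertionCoeff p n u k i ↔ i ∈ window p n m (k - m * p) := by
  have e : (m + 1) * p = m * p + p := by ring
  rw [pieceLattice, Finset.mem_Icc] at hk
  rw [mem_window_iff hp hm (by omega), (insertionCoeff_support hu hp (by omega) i k).2,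
    Nat.add_sub_cancel' hk.1, and_iff_right hi]

/-! ### Decomposition of the NURBS curve into rational Bézier pieces -/

variable {E : Type*} [NormedAddCommGroup E] [NormedSpace ℝ E]

/-- The weights after knot insertion. -/
def insertedWeight (p n : ℕ) (u w : ℕ → ℝ) (k : ℕ) : ℝ :=
  ∑ i ∈ Finset.range (n + p), insertionCoeff p n u k i * w i

/-- The control points after knot insertion. -/
def insertedPoint (p n : ℕ) (u w : ℕ → ℝ) (P : ℕ → E) (k : ℕ) : E :=
  (Finset.range (n + p)).centerMass (fun i => insertionCoeff p n u k i * w i) P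

theorem window_subset_range (hp : 1 ≤ p) {m j : ℕ} (hm : m < n) (hj : j ≤ p) :
    window p n m j ⊆ Finset.range (n + p) := fun _ hi =>
  Finset.mem_range.2 ((mem_window_iff hp hm hj).1 hi).1

theorem insertedWeight_pos (hu : StrictMonoOn u (Set.Iic n)) (hp : 1 ≤ p) {w : ℕ → ℝ}
    (hw : ∀ i < n + p, 0 < w i) {m k : ℕ} (hm : m < n) (hk : k ∈ pieceLattice p m) :
    0 < insertedWeight p n u w k := by
  have e : (m + 1) * p = m * p + p := by ring
  have hk' := hk
  rw [pieceLattice, Finset.mem_Icc] at hk'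
  obtain ⟨i, hi⟩ := window_nonempty hp hm (show k - m * p ≤ p by omega)
  have hir := window_subset_range hp hm (by omega) hi
  refine Finset.sum_pos' (fun j hj => mul_nonneg (insertionCoeff_support hu hp (by omega) j k).1
    (hw j (Finset.mem_range.1 hj)).le) ⟨i, hir, ?_⟩
  rw [Finset.mem_range] at hir
  exact mul_pos ((insertionCoeff_pos_iff_mem_window hu hp hm hk hir).2 hi) (hw i hir)

/-- On each piece, the NURBS curve is the rational Bézier curve given by knot insertion. -/
theorem nurbsPoint_eq_toricPoint (hu : StrictMonoOn u (Set.Iic n)) (hun : u n = 1)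
    (hp : 1 ≤ p) {w : ℕ → ℝ} (hw : ∀ i < n + p, 0 < w i) (P : ℕ → E) {m : ℕ} (hm : m < n) {y : ℝ}
    (hy : u m ≤ y) (hy' : y < u (m + 1) ∨ (y = 1 ∧ m + 1 = n)) :
    nurbsPoint p n u w P y = toricPoint (pieceLattice p m) (pieceBasisCoeff p m)
      (insertedWeight p n u w) (insertedPoint p n u w P)
        (m * p + p * ((y - u m) / (u (m + 1) - u m))) := by
  have hN : ∀ i ∈ Finset.range (n + p), bsplineBasis (knotVector p n u) p i y = _ := fun i hi =>
    bsplineBasis_eq_sum_toricBasis hu hun hp hm hy hy' (Finset.mem_range.1 hi)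
  rw [nurbsPoint, toricPoint, Finset.centerMass]
  congr 1
  · congr 1
    rw [Finset.sum_congr rfl fun i hi => by rw [hN i hi]]
    simp only [insertedWeight, Finset.mul_sum, Finset.sum_mul]
    rw [Finset.sum_comm]
    refine Finset.sum_congr rfl fun k _ => Finset.sum_congr rfl fun i _ => by ring
  · rw [Finset.sum_congr rfl fun i hi => by rw [hN i hi]]
    simp only [Finset.mul_sum, Finset.sum_smul]
    rw [Finset.sum_comm]
    refine Finset.sum_congr rfl fun k hk => ?_
    -- The normalization inside the inserted control point cancels against its weight, leaving the
    -- homogeneous coordinates, which are linear in the original ones.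
    have h0 := (insertedWeight_pos hu hp hw hm hk).ne'
    rw [insertedPoint, Finset.centerMass, smul_smul]
    change _ = (insertedWeight p n u w k * _ * (insertedWeight p n u w k)⁻¹) • _
    rw [mul_right_comm, mul_inv_cancel₀ h0, one_mul, Finset.smul_sum]
    refine Finset.sum_congr rfl fun i _ => ?_
    rw [smul_smul]
    congr 1
    ring

theorem toricPoint_sSup_pieceLattice (hp : 1 ≤ p) {m : ℕ} {w : ℕ → ℝ} (P : ℕ → E)
    (hw : w ((m + 1) * p) ≠ 0) :
    toricPoint (pieceLattice p m) (pieceBasisCoeff p m) w P (m * p + p * 1) = P ((m + 1) * p) := by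
  have e : (m + 1) * p = m * p + p := by ring
  have hmem : (m + 1) * p ∈ pieceLattice p m := by
    rw [pieceLattice, Finset.mem_Icc]
    omega
  have hsub : {(m + 1) * p} ⊆ pieceLattice p m := Finset.singleton_subset_iff.2 hmem
  rw [toricPoint, ← Finset.centerMass_subset P hsub, Finset.centerMass_singleton]
  · rw [toricBasis_pieceLattice hp hmem, e, Nat.add_sub_cancel_left]
    simpa [← e] using hw
  · intro k hk hne
    rw [toricBasis_pieceLattice hp hk]
    rw [Finset.mem_singleton] at hne
    rw [pieceLattice, Finset.mem_Icc] at hk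
    rw [sub_self, zero_pow (by omega)]
    simp

theorem toricPoint_sInf_pieceLattice (hp : 1 ≤ p) {m : ℕ} {w : ℕ → ℝ} (P : ℕ → E)
    (hw : w (m * p) ≠ 0) :
    toricPoint (pieceLattice p m) (pieceBasisCoeff p m) w P (m * p + p * 0) = P (m * p) := by
  have e : (m + 1) * p = m * p + p := by ring
  have hmem : m * p ∈ pieceLattice p m := by
    rw [pieceLattice, Finset.mem_Icc]
    omega
  have hsub : {m * p} ⊆ pieceLattice p m := Finset.singleton_subset_iff.2 hmem
  rw [toricPoint, ← Finset.centerMass_subset P hsub, Finset.centerMass_singleton]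
  · rw [toricBasis_pieceLattice hp hmem]
    simpa using hw
  · intro k hk hne
    rw [toricBasis_pieceLattice hp hk]
    rw [Finset.mem_singleton] at hne
    rw [pieceLattice, Finset.mem_Icc] at hk
    rw [zero_pow (by omega)]
    simp

theorem exists_piece (hu : StrictMonoOn u (Set.Iic n)) (hu0 : u 0 = 0) (hun : u n = 1)
    (hn : 1 ≤ n) {y : ℝ} (hy : y ∈ Set.Icc (0 : ℝ) 1) :
    ∃ m < n, u m ≤ y ∧ (y < u (m + 1) ∨ (y = 1 ∧ m + 1 = n)) := by
  classical
  rcases hy.2.eq_or_lt with rfl | hy1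
  · refine ⟨n - 1, by omega, ?_, Or.inr ⟨rfl, by omega⟩⟩
    rw [← hun]
    exact hu.monotoneOn (Set.mem_Iic.2 (Nat.sub_le n 1)) (Set.mem_Iic.2 le_rfl) (Nat.sub_le n 1)
  · have h : ∃ j, j < n ∧ y < u (j + 1) :=
      ⟨n - 1, by omega, by rw [Nat.sub_add_cancel hn, hun]; exact hy1⟩
    refine ⟨Nat.find h, (Nat.find_spec h).1, ?_, Or.inl (Nat.find_spec h).2⟩
    rcases Nat.eq_zero_or_pos (Nat.find h) with h0 | h0
    · rw [h0, hu0]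
      exact hy.1
    · obtain ⟨i, hi⟩ := Nat.exists_eq_add_of_le' h0
      have h1 := Nat.find_min h (m := i) (by omega)
      have h2 := (Nat.find_spec h).1
      push Not at h1
      rw [hi]
      exact h1 (by omega)

/-- The NURBS curve is the union of its rational Bézier pieces. -/
theorem nurbsCurve_eq_biUnion_toricCurve (hu : StrictMonoOn u (Set.Iic n)) (hu0 : u 0 = 0)
    (hun : u n = 1) (hp : 1 ≤ p) (hn : 1 ≤ n) {w : ℕ → ℝ} (hw : ∀ i < n + p, 0 < w i)
    (P : ℕ → E) :
    nurbsCurve p n u w P = ⋃ m ∈ Finset.range n, toricCurve (pieceLattice p m)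
      (pieceBasisCoeff p m) (insertedWeight p n u w) (insertedPoint p n u w P) := by
  have hstep : ∀ m < n, u m < u (m + 1) := fun m hm =>
    hu (Set.mem_Iic.2 hm.le) (Set.mem_Iic.2 hm) (Nat.lt_succ_self m)
  have hppos : (0 : ℝ) < p := by exact_mod_cast hp
  have hIcc : ∀ m : ℕ, Set.Icc ((sInf (pieceLattice p m : Set ℕ) : ℕ) : ℝ)
      ((sSup (pieceLattice p m : Set ℕ) : ℕ) : ℝ) = Set.Icc (m * p : ℝ) (m * p + p) := by
    intro m
    rw [sInf_pieceLattice, sSup_pieceLattice]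
    push_cast
    rw [add_mul, one_mul]
  refine Set.Subset.antisymm ?_ ?_
  · rintro _ ⟨y, hy, rfl⟩
    obtain ⟨m, hm, h1, h2⟩ := exists_piece hu hu0 hun hn hy
    have h3 : y ≤ u (m + 1) := by
      rcases h2 with h2 | ⟨h2, h2'⟩
      · exact h2.le
      · rw [h2', hun, h2]
    refine Set.mem_biUnion (Finset.mem_coe.2 (Finset.mem_range.2 hm)) ?_
    rw [nurbsPoint_eq_toricPoint hu hun hp hw P hm h1 h2, toricCurve_eq_image, hIcc]
    refine Set.mem_image_of_mem _ ?_
    have h4 := sub_pos.2 (hstep m hm)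
    have h5 : 0 ≤ (y - u m) / (u (m + 1) - u m) := div_nonneg (sub_nonneg.2 h1) h4.le
    have h6 : (y - u m) / (u (m + 1) - u m) ≤ 1 := (div_le_one h4).2 (by linarith)
    constructor <;> nlinarith
  · refine Set.iUnion₂_subset fun m hm => ?_
    rw [Finset.mem_range] at hm
    rw [toricCurve_eq_image, hIcc]
    rintro _ ⟨x, hx, rfl⟩
    have h4 := sub_pos.2 (hstep m hm)
    have h0m : 0 ≤ u m := hu0 ▸ hu.monotoneOn (Set.mem_Iic.2 (Nat.zero_le n))
      (Set.mem_Iic.2 hm.le) (Nat.zero_le m)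
    have hm1 : u (m + 1) ≤ 1 := hun ▸ hu.monotoneOn (Set.mem_Iic.2 hm) (Set.mem_Iic.2 le_rfl) hm
    obtain ⟨z, hz0, hz1, rfl⟩ : ∃ z : ℝ, 0 ≤ z ∧ z ≤ 1 ∧ x = m * p + p * z := by
      refine ⟨(x - m * p) / p, div_nonneg (by linarith [hx.1]) hppos.le,
        (div_le_one hppos).2 (by linarith [hx.2]), ?_⟩
      rw [mul_div_cancel₀ _ hppos.ne']
      ring
    have hz : (u m + z * (u (m + 1) - u m) - u m) / (u (m + 1) - u m) = z := by
      rw [add_sub_cancel_left, mul_div_cancel_right₀ _ h4.ne']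
    by_cases hlast : z < 1 ∨ m + 1 = n
    · refine ⟨u m + z * (u (m + 1) - u m), ⟨by positivity, by nlinarith⟩, ?_⟩
      have hnn : u m ≤ u m + z * (u (m + 1) - u m) := by
        linarith [mul_nonneg hz0 h4.le]
      rw [nurbsPoint_eq_toricPoint hu hun hp hw P hm hnn, hz]
      rcases hz1.lt_or_eq with h | h
      · left
        nlinarith
      · right
        have h' := hlast.resolve_left (by linarith)
        refine ⟨?_, h'⟩
        rw [h, h', hun]
        ring
    -- Parameter intervals are half-open, so the right end of an inner piece is reached as the left
    -- end of the next; both equal the common control point `(m + 1) p`.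
    · push Not at hlast
      obtain rfl : z = 1 := le_antisymm hz1 hlast.1
      have hm' : m + 1 < n := by omega
      have hmem : (m + 1) * p ∈ pieceLattice p m := by
        rw [pieceLattice, Finset.mem_Icc]
        exact ⟨Nat.mul_le_mul_right p (Nat.le_succ m), le_rfl⟩
      have hne := (insertedWeight_pos hu hp hw hm hmem).ne'
      refine ⟨u (m + 1), ⟨by linarith, hm1⟩, ?_⟩
      rw [nurbsPoint_eq_toricPoint hu hun hp hw P hm' le_rfl (Or.inl (hstep _ hm')), sub_self,
        zero_div, toricPoint_sInf_pieceLattice hp _ hne, toricPoint_sSup_pieceLattice hp _ hne]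

/-! ### The limit weights and control points -/

theorem mem_dominant_iff {lam : ℕ → ℝ} {m k i : ℕ} : i ∈ dominant p n lam m k ↔
    i ∈ window p n m (k - m * p) ∧ ∀ i' ∈ window p n m (k - m * p), lam i' ≤ lam i := by
  simp [dominant]

theorem isGreatest_pieceLift {lam : ℕ → ℝ} {m k : ℕ} (h : (window p n m (k - m * p)).Nonempty) :
    IsGreatest (lam '' (window p n m (k - m * p) : Set ℕ)) (pieceLift p n lam m k) :=
  ⟨(Set.Nonempty.image lam h).csSup_mem ((window p n m (k - m * p)).finite_toSet.image lam),
    fun _ hx => le_csSup ((window p n m (k - m * p)).finite_toSet.image lam).bddAbove hx⟩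

theorem mem_dominant_iff_eq {lam : ℕ → ℝ} {m k i : ℕ} (hi : i ∈ window p n m (k - m * p)) :
    i ∈ dominant p n lam m k ↔ lam i = pieceLift p n lam m k := by
  have hg := isGreatest_pieceLift (lam := lam) ⟨i, hi⟩
  rw [mem_dominant_iff, and_iff_right hi]
  constructor
  · intro h
    refine le_antisymm (hg.2 ⟨i, hi, rfl⟩) ?_
    obtain ⟨j, hj, hj'⟩ := hg.1
    rw [← hj']
    exact h j hj
  · intro h j hj
    rw [h]
    exact hg.2 ⟨j, hj, rfl⟩

/-- The homogeneous coordinates of the control points after knot insertion, scaled by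
`t ^ (-λ^m(k))`, converge to the part coming from the dominant indices. -/
theorem tendsto_sum_liftedWeights (hu : StrictMonoOn u (Set.Iic n)) (hp : 1 ≤ p) (lam w : ℕ → ℝ)
    {F : Type*} [NormedAddCommGroup F] [NormedSpace ℝ F] (b : ℕ → F)
    {m k : ℕ} (hm : m < n) (hk : k ∈ pieceLattice p m) :
    Tendsto (fun t : ℝ => t ^ (-pieceLift p n lam m k) • ∑ i ∈ Finset.range (n + p),
      (insertionCoeff p n u k i * liftedWeights lam w t i) • b i) atTop
      (𝓝 (∑ i ∈ dominant p n lam m k, (insertionCoeff p n u k i * w i) • b i)) := by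
  classical
  have e : (m + 1) * p = m * p + p := by ring
  have hk' := hk
  rw [pieceLattice, Finset.mem_Icc] at hk'
  have hwin := window_subset_range hp hm (show k - m * p ≤ p by omega)
  have hsub : dominant p n lam m k ⊆ Finset.range (n + p) :=
    (Finset.filter_subset _ _).trans hwin
  have hg := isGreatest_pieceLift (lam := lam) (window_nonempty hp hm (show k - m * p ≤ p by omega))
  have hlim : ∑ i ∈ dominant p n lam m k, (insertionCoeff p n u k i * w i) • b i =
      ∑ i ∈ Finset.range (n + p), (if i ∈ dominant p n lam m k then (1 : ℝ) else 0) •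
        ((insertionCoeff p n u k i * w i) • b i) := by
    simp only [ite_smul, one_smul, zero_smul]
    rw [Finset.sum_ite_mem, Finset.inter_eq_right.2 hsub]
  rw [hlim]
  have hcongr : ∀ᶠ t : ℝ in atTop, ∑ i ∈ Finset.range (n + p),
      t ^ (lam i - pieceLift p n lam m k) • ((insertionCoeff p n u k i * w i) • b i) =
      t ^ (-pieceLift p n lam m k) • ∑ i ∈ Finset.range (n + p),
      (insertionCoeff p n u k i * liftedWeights lam w t i) • b i := by
    filter_upwards [eventually_gt_atTop 0] with t ht
    rw [Finset.smul_sum]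
    refine Finset.sum_congr rfl fun i _ => ?_
    rw [smul_smul, smul_smul, sub_eq_add_neg, Real.rpow_add ht, liftedWeights]
    congr 1
    ring
  refine Tendsto.congr' hcongr (tendsto_finsetSum _ fun i hi => ?_)
  rw [Finset.mem_range] at hi
  by_cases hiw : i ∈ window p n m (k - m * p)
  · refine Tendsto.smul_const ?_ _
    split_ifs with hd
    · rw [(mem_dominant_iff_eq hiw).1 hd, sub_self]
      simp
    · have hlt : lam i < pieceLift p n lam m k :=
        lt_of_le_of_ne (hg.2 ⟨i, hiw, rfl⟩) (mt (mem_dominant_iff_eq hiw).2 hd)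
      have := tendsto_rpow_neg_atTop (y := pieceLift p n lam m k - lam i) (by linarith)
      simpa using this
  -- Outside the window `lam i` may exceed the maximum, but there the coefficient is exactly zero.
  · have h0 : insertionCoeff p n u k i = 0 :=
      le_antisymm (not_lt.1 (mt (insertionCoeff_pos_iff_mem_window hu hp hm hk hi).1 hiw))
        (insertionCoeff_support hu hp (by omega) i k).1
    simp [h0]

theorem tendsto_insertedWeight (hu : StrictMonoOn u (Set.Iic n)) (hp : 1 ≤ p) (lam w : ℕ → ℝ)
    {m k : ℕ} (hm : m < n) (hk : k ∈ pieceLattice p m) :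
    Tendsto (fun t : ℝ => t ^ (-pieceLift p n lam m k) *
      insertedWeight p n u (liftedWeights lam w t) k) atTop (𝓝 (limitWeight p n u lam w m k)) := by
  -- The weight is the homogeneous sum with every control point replaced by the real number `1`.
  simpa [insertedWeight, limitWeight] using
    tendsto_sum_liftedWeights hu hp lam w (fun _ => (1 : ℝ)) hm hk

theorem limitWeight_pos (hu : StrictMonoOn u (Set.Iic n)) (hp : 1 ≤ p) (lam : ℕ → ℝ) {w : ℕ → ℝ}
    (hw : ∀ i < n + p, 0 < w i) {m k : ℕ} (hm : m < n) (hk : k ∈ pieceLattice p m) :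
    0 < limitWeight p n u lam w m k := by
  have e : (m + 1) * p = m * p + p := by ring
  have hk' := hk
  rw [pieceLattice, Finset.mem_Icc] at hk'
  refine Finset.sum_pos (fun i hi => ?_) ?_
  · have hi1 := (mem_dominant_iff.1 hi).1
    have hi2 := Finset.mem_range.1 (window_subset_range hp hm (by omega) hi1)
    exact mul_pos ((insertionCoeff_pos_iff_mem_window hu hp hm hk hi2).2 hi1) (hw i hi2)
  · obtain ⟨i, hi, hmax⟩ := (window p n m (k - m * p)).exists_max_image lam
      (window_nonempty hp hm (by omega))
    exact ⟨i, mem_dominant_iff.2 ⟨hi, hmax⟩⟩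

theorem tendsto_insertedPoint (hu : StrictMonoOn u (Set.Iic n)) (hp : 1 ≤ p) (lam : ℕ → ℝ)
    {w : ℕ → ℝ} (hw : ∀ i < n + p, 0 < w i) (P : ℕ → E) {m k : ℕ} (hm : m < n)
    (hk : k ∈ pieceLattice p m) :
    Tendsto (fun t : ℝ => insertedPoint p n u (liftedWeights lam w t) P k) atTop
      (𝓝 (limitPoint p n u lam w P m k)) := by
  have h1 := ((tendsto_insertedWeight hu hp lam w hm hk).inv₀
    (limitWeight_pos hu hp lam hw hm hk).ne').smul (tendsto_sum_liftedWeights hu hp lam w P hm hk)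
  refine h1.congr' ?_
  filter_upwards [eventually_gt_atTop 0] with t ht
  have h2 : t ^ (-pieceLift p n lam m k) ≠ 0 := (Real.rpow_pos_of_pos ht _).ne'
  rw [smul_smul, mul_inv, mul_right_comm, inv_mul_cancel₀ h2, one_mul]
  rfl

end Piece

/-! ### Convergence -/

theorem hausdorffEDist_biUnion_le {α ι : Type*} [PseudoEMetricSpace α] {I : Finset ι}
    {S T : ι → Set α} {r : ENNReal} (h : ∀ i ∈ I, Metric.hausdorffEDist (S i) (T i) ≤ r) :
    Metric.hausdorffEDist (⋃ i ∈ I, S i) (⋃ i ∈ I, T i) ≤ r := by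
  refine Metric.hausdorffEDist_le_of_infEDist (fun x hx => ?_) fun x hx => ?_
  · obtain ⟨i, hi, hxi⟩ := Set.mem_iUnion₂.1 hx
    exact (Metric.infEDist_anti (Set.subset_biUnion_of_mem (u := T) hi)).trans
      ((Metric.infEDist_le_hausdorffEDist_of_mem hxi).trans (h i hi))
  · obtain ⟨i, hi, hxi⟩ := Set.mem_iUnion₂.1 hx
    refine (Metric.infEDist_anti (Set.subset_biUnion_of_mem (u := S) hi)).trans
      ((Metric.infEDist_le_hausdorffEDist_of_mem hxi).trans ?_)
    rw [Metric.hausdorffEDist_comm]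
    exact h i hi

theorem pieceBasisCoeff_pos {p m k : ℕ} (hp : 1 ≤ p) (hk : k ∈ pieceLattice p m) :
    0 < pieceBasisCoeff p m k := by
  have e : (m + 1) * p = m * p + p := by ring
  rw [pieceLattice, Finset.mem_Icc] at hk
  have h1 : 0 < p.choose (k - m * p) := Nat.choose_pos (by omega)
  unfold pieceBasisCoeff
  positivity

end NURBS

end

theorem theorem3 (d p n : ℕ) (hp : 1 ≤ p) (hn : 1 ≤ n)
    (u : ℕ → ℝ) (hu0 : u 0 = 0) (hun : u n = 1) (hu : ∀ i < n, u i < u (i + 1))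
    (P : ℕ → EuclideanSpace ℝ (Fin d)) (w : ℕ → ℝ) (hw : ∀ i < n + p, 0 < w i)
    (lam : ℕ → ℝ) :
    Filter.Tendsto
      (fun t : ℝ => Metric.hausdorffEDist
        (NURBS.nurbsCurve p n u (NURBS.liftedWeights lam w t) P)
        (NURBS.regularControlCurve p n u lam w P))
      Filter.atTop (nhds 0) := by
  have hu' := NURBS.strictMonoOn_of_lt_succ hu
  have hwt : ∀ t : ℝ, 0 < t → ∀ i < n + p, 0 < NURBS.liftedWeights lam w t i := fun t ht i hi =>
    mul_pos (Real.rpow_pos_of_pos ht _) (hw i hi)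
  have hpiece : ∀ m ∈ Finset.range n, Filter.Tendsto (fun t : ℝ => Metric.hausdorffEDist
      (NURBS.toricCurve (NURBS.pieceLattice p m) (NURBS.pieceBasisCoeff p m)
        (NURBS.insertedWeight p n u (NURBS.liftedWeights lam w t))
        (NURBS.insertedPoint p n u (NURBS.liftedWeights lam w t) P))
      (⋃ s ∈ NURBS.regularDecomposition (NURBS.pieceLattice p m) (NURBS.pieceLift p n lam m),
        NURBS.toricCurve s (NURBS.pieceBasisCoeff p m) (NURBS.limitWeight p n u lam w m)
          (NURBS.limitPoint p n u lam w P m))) Filter.atTop (nhds 0) := by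
    intro m hm
    rw [Finset.mem_range] at hm
    exact NURBS.tendsto_hausdorffEDist_toricCurve (NURBS.pieceLattice_nontrivial hp m)
      (fun k hk => NURBS.pieceBasisCoeff_pos hp hk)
      (fun k hk => NURBS.limitWeight_pos hu' hp lam hw hm hk)
      (fun t ht k hk => NURBS.insertedWeight_pos hu' hp (hwt t ht) hm hk)
      (fun k hk => NURBS.tendsto_insertedWeight hu' hp lam w hm hk)
      (fun k hk => NURBS.tendsto_insertedPoint hu' hp lam hw P hm hk)
  rw [ENNReal.tendsto_nhds_zero]
  intro ε hε
  have hall := (Filter.eventually_all_finset (Finset.range n)).2 fun m hm =>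
    ENNReal.tendsto_nhds_zero.1 (hpiece m hm) ε hε
  filter_upwards [hall, Filter.eventually_gt_atTop 0] with t ht ht0
  -- Splitting into pieces needs positive lifted weights, hence `t > 0`; the common bound on
  -- finitely many pieces passes to their union.
  rw [NURBS.nurbsCurve_eq_biUnion_toricCurve hu' hu0 hun hp hn (hwt t ht0),
    NURBS.regularControlCurve]
  exact NURBS.hausdorffEDist_biUnion_le ht
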